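/- Let $K$ be a field of characteristic zero. Let $V=\bigoplus_{n\ge n_0}V_{[n]}$ be a vertex operator (super)algebra over $K$ with parity $|\cdot|$, vacuum $\mathbf 1$, modes $v(z)=\sum_n v_n z^{-n-1}$ and Wick product $ab:=a_{-1}b$, and let $Q$ be an odd square-zero derivation of the Wick product (so $(V,\mathrm{Wick},\mathbf 1,Q)$ is a differential VOA). Let $\Delta$ be an odd, square-zero operator of weight zero on $V$ with $\Delta\mathbf 1=0$. Define $\Phi^1_\Delta(a)=\Delta(a)-\Delta(\mathbf 1)a$ and, for homogeneous arguments, $$\Phi^{r+1}_\Delta(a_1,\dots,a_{r+1})=\Phi^r_\Delta(a_1,\dots,a_ra_{r+1})-\Phi^r_\Delta(a_1,\dots,a_r)a_{r+1}-(-1)^{|a_r|(1+|a_1|+\cdots+|a_{r-1}|)}a_r\Phi^r_\Delta(a_1,\dots,a_{r-1},a_{r+1}).$$ An $L_\infty$ structure on a super vector space means a sequence of odd, graded symmetric $n$-ary brackets ($n\ge 1$) such that for all $r\ge1$ and homogeneous $a_1,\dots,a_r$ $$\sum_{k=1}^{r}\ \sum_{\sigma}(-1)^{\epsilon}\,[[a_{\sigma(1)},\dots,a_{\sigma(k)}]_k,a_{\sigma(k+1)},\dots,a_{\sigma(r)}]_{r-k+1}=0,$$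 where $\sigma$ runs over the $(k,r-k)$-unshuffles and $(-1)^\epsilon$ is the Koszul sign. Let $H(V,Q)=\operatorname{Ker}Q/\operatorname{Im}Q$. (i) Assume that $[Q,\Delta]=Q\Delta+\Delta Q=0$ on $V$ and that the Wick product is graded commutative and associative in cohomology, i.e. on $Q$-closed elements modulo $\operatorname{Im}Q$. Then $\Phi^r_\Delta$ of $Q$-closed elements is $Q$-closed, the forms $\Phi^r_\Delta$ ($r\ge1$) descend to $H(V,Q)$, and the induced brackets form an $L_\infty$ structure on $H(V,Q)$. (ii) Assume only that $Q$ preserves weights, that $[Q,\Delta]=0$ on $V_{[0]}$, and that the Wick product is graded commutative and associative modulo $\operatorname{Im}Q$ on the $Q$-closed elements of $V_{[0]}$. Then in the same way the $\Phi^r_\Delta$, evaluated on $Q$-closed elements of $V_{[0]}$, define an $L_\infty$ structure on the weight-zero part $H(V,Q)_{[0]}$ of $H(V,Q)$, i.e. the space of classes having a $Q$-closed representative in $V_{[0]}$ (which is all of $H(V,Q)$ when the cohomology is concentrated in weight zero). In both cases, if moreover $\Delta=v_k$ is a mode of some vertex operator $v(z)$ with $k\ge1$, then the $n$-ary brackets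 vanish for all $n>k+1$. -/

import Mathlib

open scoped VertexOperator

noncomputable section

/-! ### Super-graded sign conventions and `L∞` algebras -/

/-- The Koszul sign of the rearrangement `(a₁, …, aₙ) ↦ (a_{σ(1)}, …, a_{σ(n)})` of elements of
parities `d₁, …, dₙ`: one factor `(-1)^{|a_{σ(i)}||a_{σ(j)}|}` for each pair `i < j` with
`σ(i) > σ(j)`. -/
def koszulSign {n : ℕ} (σ : Equiv.Perm (Fin n)) (d : Fin n → ZMod 2) : ℤˣ :=
  ∏ p : Fin n × Fin n with p.1 < p.2 ∧ σ p.2 < σ p.1, (-1 : ℤˣ) ^ (d (σ p.1) * d (σ p.2))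

/-- `(k, n - k)`-unshuffles: permutations increasing on the first `k` and on the last `n - k`
positions. -/
def IsUnshuffle {n : ℕ} (k : ℕ) (σ : Equiv.Perm (Fin n)) : Prop :=
  (∀ i j : Fin n, i < j → (j : ℕ) < k → σ i < σ j) ∧
    (∀ i j : Fin n, i < j → k ≤ (i : ℕ) → σ i < σ j)

instance {n : ℕ} (k : ℕ) : DecidablePred (IsUnshuffle (n := n) k) := fun σ =>
  inferInstanceAs (Decidable ((∀ i j : Fin n, i < j → (j : ℕ) < k → σ i < σ j) ∧
    (∀ i j : Fin n, i < j → k ≤ (i : ℕ) → σ i < σ j)))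

/-- A (strict) `L∞` structure on the super vector space `A = 𝒜 0 ⊕ 𝒜 1`: odd, graded symmetric
brackets of all arities `n ≥ 1` satisfying the higher Jacobi identities. -/
structure LInfinityAlgebra (K A : Type*) [Field K] [AddCommGroup A] [Module K A]
    (𝒜 : ZMod 2 → Submodule K A) where
  /-- the super grading is a direct sum decomposition -/
  grading : DirectSum.IsInternal 𝒜
  /-- the `n`-ary bracket -/
  bracket : (n : ℕ) → MultilinearMap K (fun _ : Fin n => A) A
  /-- strictness: there is no `0`-ary bracket -/
  bracket_zero : bracket 0 = 0
  /-- the brackets are odd -/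
  odd : ∀ (n : ℕ) (d : Fin n → ZMod 2) (a : Fin n → A), (∀ i, a i ∈ 𝒜 (d i)) →
    bracket n a ∈ 𝒜 (1 + ∑ i, d i)
  /-- the brackets are graded symmetric -/
  symm : ∀ (n : ℕ) (σ : Equiv.Perm (Fin n)) (d : Fin n → ZMod 2) (a : Fin n → A),
    (∀ i, a i ∈ 𝒜 (d i)) →
      bracket n (fun i => a (σ i)) = koszulSign σ d • bracket n a
  /-- the Jacobi identity in arity `r`; the inner bracket has arity `k + 1 ∈ {1, …, r}` -/
  jacobi : ∀ (r : ℕ) (d : Fin r → ZMod 2) (a : Fin r → A), (∀ i, a i ∈ 𝒜 (d i)) →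
    ∑ k : Fin r, ∑ σ : Equiv.Perm (Fin r) with IsUnshuffle ((k : ℕ) + 1) σ,
      koszulSign σ d •
        bracket (r - ((k : ℕ) + 1) + 1)
          (Fin.cons
            (bracket ((k : ℕ) + 1) fun i => a (σ (Fin.castLE (Nat.succ_le_of_lt k.2) i)))
            (fun j : Fin (r - ((k : ℕ) + 1)) => a (σ ⟨(k : ℕ) + 1 + (j : ℕ), by omega⟩))) = 0

/-! ### The higher order forms `Φ` -/

/-- The form `Φ^{r+1}_Δ(a₁, …, a_{r+1})` of an operator `Δ` of parity `δ` on a (not necessarily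
commutative or associative) superalgebra with product `m` and unit `e`, on homogeneous arguments
`aᵢ` of parity `dᵢ`:
`Φ¹(a) = Δ(a) - Δ(e) a` and
`Φ^{r+1}(a₁, …, a_r, a_{r+1}) = Φ^r(a₁, …, a_r a_{r+1}) - Φ^r(a₁, …, a_r) a_{r+1}
  - (-1)^{|a_r| (|Δ| + |a₁| + ⋯ + |a_{r-1}|)} a_r Φ^r(a₁, …, a_{r-1}, a_{r+1})`. -/
def Phi {K A : Type*} [Field K] [AddCommGroup A] [Module K A]
    (m : A →ₗ[K] A →ₗ[K] A) (e : A) (Δ : Module.End K A) (δ : ZMod 2) :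
    (r : ℕ) → (Fin (r + 1) → ZMod 2) → (Fin (r + 1) → A) → A
  | 0, _, a => Δ (a 0) - m (Δ e) (a 0)
  | r + 1, d, a =>
    let p : Fin r → A := fun i => a i.castSucc.castSucc
    let dp : Fin r → ZMod 2 := fun i => d i.castSucc.castSucc
    let x : A := a (Fin.last r).castSucc
    let dx : ZMod 2 := d (Fin.last r).castSucc
    let y : A := a (Fin.last (r + 1))
    let dy : ZMod 2 := d (Fin.last (r + 1))
    Phi m e Δ δ r (Fin.snoc (α := fun _ => ZMod 2) dp (dx + dy))
        (Fin.snoc (α := fun _ => A) p (m x y))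
      - m (Phi m e Δ δ r (Fin.snoc (α := fun _ => ZMod 2) dp dx)
        (Fin.snoc (α := fun _ => A) p x)) y
      - ((-1 : ℤˣ) ^ (dx * (δ + ∑ i, dp i))) •
        m x (Phi m e Δ δ r (Fin.snoc (α := fun _ => ZMod 2) dp dy)
          (Fin.snoc (α := fun _ => A) p y))

/-! ### Vertex operator algebras -/

/-- A vertex operator (super)algebra over `K`, with integral weights bounded below. -/
structure VertexOperatorAlgebra (K V : Type*) [Field K] [AddCommGroup V] [Module K V] where
  /-- the homogeneous subspaces for the super degree -/
  parity : ZMod 2 → Submodule K V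
  /-- the homogeneous subspaces `V_[n]` for the weight -/
  weight : ℤ → Submodule K V
  parity_internal : DirectSum.IsInternal parity
  weight_internal : DirectSum.IsInternal weight
  /-- the two gradings are compatible -/
  weight_le : ∀ n, weight n ≤ (weight n ⊓ parity 0) ⊔ (weight n ⊓ parity 1)
  weight_bounded : ∃ n₀ : ℤ, ∀ n < n₀, weight n = ⊥
  /-- the state-field map `v ↦ v(z) = ∑ vₙ z^{-n-1}`; `(Y v)[[n]]` is the mode `vₙ` -/
  Y : V →ₗ[K] VertexOperator K V
  /-- the vacuum vector -/
  one : V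
  /-- the conformal vector -/
  omega : V
  /-- the central charge -/
  charge : K
  one_mem : one ∈ weight 0 ⊓ parity 0
  omega_mem : omega ∈ weight 2 ⊓ parity 0
  mode_parity : ∀ (i j : ZMod 2) (n : ℤ) (a b : V), a ∈ parity i → b ∈ parity j →
    ((Y a)[[n]]) b ∈ parity (i + j)
  mode_weight : ∀ (k l n : ℤ) (a b : V), a ∈ weight k → b ∈ weight l →
    ((Y a)[[n]]) b ∈ weight (k + l - n - 1)
  /-- `1(z) = id` -/
  one_mode : ∀ (n : ℤ) (a : V), ((Y one)[[n]]) a = if n = -1 then a else 0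
  /-- `v(z) 1` is regular at `z = 0` with value `v` there -/
  mode_one_neg_one : ∀ a : V, ((Y a)[[(-1 : ℤ)]]) one = a
  mode_one_nonneg : ∀ (n : ℤ) (a : V), 0 ≤ n → ((Y a)[[n]]) one = 0
  /-- the Jacobi (Borcherds) identity; all sums have finitely many nonzero terms -/
  borcherds : ∀ (i j : ZMod 2) (a b c : V), a ∈ parity i → b ∈ parity j → ∀ p q r : ℤ,
    ∑ᶠ s : ℕ, Ring.choose p s • ((Y (((Y a)[[r + s]]) b))[[p + q - s]]) c =
      ∑ᶠ s : ℕ, ((-1) ^ s * Ring.choose r s) •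
        (((Y a)[[p + r - s]]) (((Y b)[[q + s]]) c)
          - ((-1 : ℤˣ) ^ (i * j) * (-1 : ℤˣ) ^ r) •
            ((Y b)[[q + r - s]]) (((Y a)[[p + s]]) c))
  /-- the Virasoro relations for `L_n = ω_{n+1}` -/
  virasoro : ∀ (k l : ℤ) (a : V),
    ((Y omega)[[k + 1]]) (((Y omega)[[l + 1]]) a) - ((Y omega)[[l + 1]]) (((Y omega)[[k + 1]]) a)
      = (k - l) • ((Y omega)[[k + l + 1]]) a
        + (if k + l = 0 then (((k : K) ^ 3 - (k : K)) / 12 * charge) • a else 0)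
  /-- `V_[n]` is the eigenspace of `L_0 = ω_1` for the eigenvalue `n` -/
  L_zero : ∀ (n : ℤ) (a : V), a ∈ weight n → ((Y omega)[[(1 : ℤ)]]) a = n • a
  /-- `(L_{-1} a)(z) = (d/dz) a(z)` -/
  L_neg_one : ∀ (n : ℤ) (a b : V),
    ((Y (((Y omega)[[(0 : ℤ)]]) a))[[n]]) b = (-n) • ((Y a)[[n - 1]]) b

namespace VertexOperatorAlgebra

variable {K V : Type*} [Field K] [AddCommGroup V] [Module K V]

/-- The product `v ×ₙ w = vₙ(w)`, a bilinear map; `D.mode n v` is the mode `vₙ` of `v(z)`. -/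
def mode (D : VertexOperatorAlgebra K V) (n : ℤ) : V →ₗ[K] V →ₗ[K] V :=
  (LinearMap.proj n) ∘ₗ VertexOperator.ncoeff ∘ₗ D.Y

/-- The Wick product `v ×₋₁ w`. -/
def wick (D : VertexOperatorAlgebra K V) : V →ₗ[K] V →ₗ[K] V := D.mode (-1)

end VertexOperatorAlgebra

/-- A differential VOA `(V, Wick, 1, Q)`: a VOA with an odd, square-zero derivation `Q` of the Wick
product. -/
structure DifferentialVOA (K V : Type*) [Field K] [AddCommGroup V] [Module K V] extends
    VertexOperatorAlgebra K V where
  /-- the differential -/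
  Q : Module.End K V
  Q_odd : ∀ (i : ZMod 2) (a : V), a ∈ parity i → Q a ∈ parity (i + 1)
  Q_sq : ∀ a : V, Q (Q a) = 0
  Q_wick : ∀ (i : ZMod 2) (a b : V), a ∈ parity i →
    Q (toVertexOperatorAlgebra.wick a b) =
      toVertexOperatorAlgebra.wick (Q a) b
        + ((-1 : ℤˣ) ^ i) • toVertexOperatorAlgebra.wick a (Q b)

namespace DifferentialVOA

variable {K V : Type*} [Field K] [AddCommGroup V] [Module K V]

/-- The cohomology `H(V, Q) = Ker Q / Im Q`. -/
abbrev Cohomology (D : DifferentialVOA K V) : Type _ :=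
  LinearMap.ker D.Q ⧸ (LinearMap.range D.Q).comap (LinearMap.ker D.Q).subtype

/-- The cohomology class of a `Q`-closed element. -/
def cls (D : DifferentialVOA K V) (a : V) (ha : D.Q a = 0) : D.Cohomology :=
  Submodule.Quotient.mk ⟨a, LinearMap.mem_ker.mpr ha⟩

/-- The subspace of `H(V, Q)` of all classes that have a `Q`-closed representative in `W`. -/
def classesOf (D : DifferentialVOA K V) (W : Submodule K V) : Submodule K D.Cohomology :=
  (W.comap (LinearMap.ker D.Q).subtype).map (Submodule.mkQ _)

/-- The super grading of `H(V, Q)` induced by that of `V`. -/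
def cohomologyParity (D : DifferentialVOA K V) (i : ZMod 2) : Submodule K D.Cohomology :=
  D.classesOf (D.parity i)

/-- The weight-zero part `H(V, Q)_[0]` of the cohomology. -/
def cohomologyZero (D : DifferentialVOA K V) : Submodule K D.Cohomology :=
  D.classesOf (D.weight 0)

/-- The super grading of `H(V, Q)_[0]`. -/
def cohomologyZeroParity (D : DifferentialVOA K V) (i : ZMod 2) :
    Submodule K D.cohomologyZero :=
  (D.cohomologyParity i).comap D.cohomologyZero.subtype

/-- The Wick product of `Q`-closed elements of `W` is graded commutative and associative up to
`Q`-exact terms. -/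
def WickCommAssocOn (D : DifferentialVOA K V) (W : Submodule K V) : Prop :=
  (∀ (i j : ZMod 2) (a b : V), a ∈ W → b ∈ W → a ∈ D.parity i → b ∈ D.parity j →
    D.Q a = 0 → D.Q b = 0 →
      D.wick a b - ((-1 : ℤˣ) ^ (i * j)) • D.wick b a ∈ LinearMap.range D.Q) ∧
  (∀ a b c : V, a ∈ W → b ∈ W → c ∈ W → D.Q a = 0 → D.Q b = 0 → D.Q c = 0 →
    D.wick (D.wick a b) c - D.wick a (D.wick b c) ∈ LinearMap.range D.Q)

/-- The form `Φ^{r+1}_Δ` of an odd operator `Δ` with respect to the Wick product. -/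
def wickPhi (D : DifferentialVOA K V) (Δ : Module.End K V) (r : ℕ)
    (d : Fin (r + 1) → ZMod 2) (a : Fin (r + 1) → V) : V :=
  Phi D.wick D.one Δ 1 r d a

end DifferentialVOA

end

noncomputable section

/-! ### Supercommutative algebras and iterated brackets of operators -/

/-! Modulo exact terms the Wick product becomes unital, associative and supercommutative, and `Δ`
becomes an odd square-zero operator `T` killing the unit. Over such an algebra Koszul's
derived-bracket description holds: `Φ^r_T(a₁, …, a_r) = [⋯[T, a₁], …, a_r] 1`, with supercommutators
against left multiplications (`Phi_eq_listForm`). Graded symmetry follows because left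
multiplications supercommute (`superBracket_swap`, `listForm_perm`).

The Jacobi identity is polarized. For two operators, the signed sum over all splittings of
`Φ_{T₁}(Φ_{T₂}(P), R)`, super-antisymmetrized in `T₁, T₂`, equals the form of the supercommutator
`[T₁, T₂]` (`nestedSum_supercommutator`). This goes by induction on the number of arguments, since
`[·, a]` is a superderivation of composition. At `T₁ = T₂ = T` it says that twice the Jacobi sum is
the form of `2T² = 0`. Splittings are then matched with unshuffles (`splitSum_finRange`).

The vanishing for `Δ = v_k` holds already on `V`, where the product is neither commutative nor
associative. `Φ^{r+1}_T` equals `Φ^r` of the derivation defect of `T` at the first argument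
(`Phi_succ_eq_derivationDefect`), and by the Borcherds identity the defect of `v_k` is a combination
of modes with index in `[0, k)` (`derivationDefect_mode`).

Both cases of the theorem are one argument for a subspace `W` (all of `V`, or `V_[0]`) whose closed
elements carry the structure (`IsAdapted.exists_lInfinityAlgebra`). -/

theorem map_units_int_smul {A B F : Type*} [AddCommGroup A] [AddCommGroup B] [FunLike F A B]
    [AddMonoidHomClass F A B] (f : F) (s : ℤˣ) (a : A) : f (s • a) = s • f a := by
  rw [Units.smul_def, map_zsmul, Units.smul_def]

theorem zmod_two_eq_zero_or_one (i : ZMod 2) : i = 0 ∨ i = 1 := by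
  revert i; decide

/-! ### Projections onto homogeneous components -/

section GradedProjection

variable {ι K A : Type*} [DecidableEq ι] [Field K] [AddCommGroup A] [Module K A]
  {𝒜 : ι → Submodule K A}

/-- The projection of a graded vector space onto its homogeneous subspace of degree `i`. -/
def gradedProj (h : DirectSum.IsInternal 𝒜) (i : ι) : A →ₗ[K] A :=
  (𝒜 i).subtype ∘ₗ DirectSum.component K (ι) (fun i => 𝒜 i) i ∘ₗ
    (LinearEquiv.ofBijective (DirectSum.coeLinearMap 𝒜)
      (show Function.Bijective (DirectSum.coeLinearMap 𝒜) from h)).symm.toLinearMap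

theorem gradedProj_mem (h : DirectSum.IsInternal 𝒜) (i : ι) (a : A) :
    gradedProj h i a ∈ 𝒜 i := by
  simp [gradedProj]

theorem gradedProj_of_mem (h : DirectSum.IsInternal 𝒜) {i : ι} {a : A} (ha : a ∈ 𝒜 i)
    (j : ι) : gradedProj h j a = if i = j then a else 0 := by
  have key : (LinearEquiv.ofBijective (DirectSum.coeLinearMap 𝒜)
      (show Function.Bijective (DirectSum.coeLinearMap 𝒜) from h)).symm a
      = DirectSum.lof K (ι) (fun i => 𝒜 i) i ⟨a, ha⟩ := by
    rw [LinearEquiv.symm_apply_eq]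
    simp
  simp only [gradedProj, LinearMap.comp_apply, LinearEquiv.coe_coe, key]
  rw [DirectSum.component.of]
  split_ifs with hij
  · subst hij; rfl
  · simp

theorem linearMap_ext_of_isInternal (h : DirectSum.IsInternal 𝒜) {B : Type*} [AddCommGroup B]
    [Module K B] {f g : A →ₗ[K] B} (hfg : ∀ i, ∀ a ∈ 𝒜 i, f a = g a) : f = g := by
  ext a
  obtain ⟨x, rfl⟩ := h.2 a
  induction x using DirectSum.induction_on with
  | zero => simp
  | of i x => simpa using hfg i x x.2
  | add x y hx hy => simp only [map_add, hx, hy]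

end GradedProjection

section ParityProjection

variable {K A : Type*} [Field K] [AddCommGroup A] [Module K A] {𝒜 : ZMod 2 → Submodule K A}

theorem sum_gradedProj (h : DirectSum.IsInternal 𝒜) (a : A) : ∑ i, gradedProj h i a = a := by
  obtain ⟨x, rfl⟩ := h.2 a
  induction x using DirectSum.induction_on with
  | zero => simp
  | of i x =>
    simp only [DirectSum.coeAddMonoidHom_of]
    simp [gradedProj_of_mem h x.2]
  | add x y hx hy => simp only [map_add, Finset.sum_add_distrib, hx, hy]

theorem gradedProj_zero_add_one (h : DirectSum.IsInternal 𝒜) (a : A) :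
    gradedProj h 0 a + gradedProj h 1 a = a := by
  conv_rhs => rw [← sum_gradedProj h a]
  exact (Fin.sum_univ_two fun i : Fin 2 => gradedProj h i a).symm

theorem multilinearMap_eq_zero_of_parity (h : DirectSum.IsInternal 𝒜) {n : ℕ} {B : Type*}
    [AddCommGroup B] [Module K B] {f : MultilinearMap K (fun _ : Fin n => A) B}
    (hf : ∀ (d : Fin n → ZMod 2) (a : Fin n → A), (∀ i, a i ∈ 𝒜 (d i)) → f a = 0) : f = 0 := by
  ext a
  have : a = fun i => ∑ j, gradedProj h j (a i) := by
    funext i; rw [sum_gradedProj]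
  rw [this, MultilinearMap.map_sum]
  exact Finset.sum_eq_zero fun d _ => hf d _ fun i => gradedProj_mem h _ _

/-- The operator `T` has parity `δ`. -/
def HasOperatorParity (𝒜 : ZMod 2 → Submodule K A) (δ : ZMod 2) (T : Module.End K A) : Prop :=
  ∀ (i : ZMod 2) (a : A), a ∈ 𝒜 i → T a ∈ 𝒜 (i + δ)

end ParityProjection

/-- A unital, associative, supercommutative product on `A = 𝒜 0 ⊕ 𝒜 1`. -/
structure SupercommutativeAlgebra (K A : Type*) [Field K] [AddCommGroup A] [Module K A]
    (𝒜 : ZMod 2 → Submodule K A) where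
  /-- the product -/
  mul : A →ₗ[K] A →ₗ[K] A
  /-- the unit -/
  one : A
  internal : DirectSum.IsInternal 𝒜
  one_mem : one ∈ 𝒜 0
  mul_mem : ∀ (i j : ZMod 2) (a b : A), a ∈ 𝒜 i → b ∈ 𝒜 j → mul a b ∈ 𝒜 (i + j)
  one_mul : ∀ a : A, mul one a = a
  mul_assoc : ∀ a b c : A, mul (mul a b) c = mul a (mul b c)
  mul_comm : ∀ (i j : ZMod 2) (a b : A), a ∈ 𝒜 i → b ∈ 𝒜 j →
    mul a b = ((-1 : ℤˣ) ^ (i * j)) • mul b a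

namespace SupercommutativeAlgebra

variable {K A : Type*} [Field K] [AddCommGroup A] [Module K A] {𝒜 : ZMod 2 → Submodule K A}
  (S : SupercommutativeAlgebra K A 𝒜)

theorem mul_one (a : A) : S.mul a S.one = a := by
  have : S.mul.flip S.one = LinearMap.id := linearMap_ext_of_isInternal S.internal fun i a ha => by
    simp [S.mul_comm _ _ _ _ ha S.one_mem, S.one_mul]
  exact congrArg (fun f => f a) this

theorem mul_left_comm {i j : ZMod 2} {a b : A} (ha : a ∈ 𝒜 i) (hb : b ∈ 𝒜 j) (c : A) :
    S.mul a (S.mul b c) = ((-1 : ℤˣ) ^ (i * j)) • S.mul b (S.mul a c) := by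
  rw [← S.mul_assoc, ← S.mul_assoc, S.mul_comm _ _ _ _ ha hb, map_units_int_smul,
    Units.smul_def, Units.smul_def, LinearMap.smul_apply]

/-- The parity involution. -/
def parityInvolution : Module.End K A := gradedProj S.internal 0 - gradedProj S.internal 1

theorem parityInvolution_of_mem {i : ZMod 2} {a : A} (ha : a ∈ 𝒜 i) :
    S.parityInvolution a = ((-1 : ℤˣ) ^ i) • a := by
  obtain rfl | rfl := zmod_two_eq_zero_or_one i
  · simp [parityInvolution, gradedProj_of_mem S.internal ha]
  · simp [parityInvolution, gradedProj_of_mem S.internal ha,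
      show (-1 : ℤˣ) ^ (1 : ZMod 2) = -1 by decide]

/-- The supercommutator `[T, a]` of an operator `T` with the multiplication by `a`. -/
def superBracket : Module.End K A →ₗ[K] A →ₗ[K] Module.End K A :=
  LinearMap.mk₂ K
    (fun T a => T ∘ₗ S.mul a - S.mul (gradedProj S.internal 0 a) ∘ₗ T
      - S.mul (gradedProj S.internal 1 a) ∘ₗ S.parityInvolution ∘ₗ T ∘ₗ S.parityInvolution)
    (fun T T' a => by ext b; simp; abel)
    (fun c T a => by ext b; simp [smul_sub])
    (fun T a a' => by ext b; simp; abel)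
    (fun c T a => by ext b; simp [smul_sub])

theorem superBracket_apply {δ i : ZMod 2} {T : Module.End K A} {a : A}
    (hT : HasOperatorParity 𝒜 δ T) (ha : a ∈ 𝒜 i) (b : A) :
    S.superBracket T a b = T (S.mul a b) - ((-1 : ℤˣ) ^ (δ * i)) • S.mul a (T b) := by
  -- Conjugation by the parity involution produces the sign of `T`, which is how the bracket can be
  -- bilinear with no parities supplied.
  have conj : S.parityInvolution ∘ₗ T ∘ₗ S.parityInvolution = ((-1 : ℤˣ) ^ δ) • T := by
    refine linearMap_ext_of_isInternal S.internal fun j b hb => ?_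
    rw [LinearMap.comp_apply, LinearMap.comp_apply, S.parityInvolution_of_mem hb,
      map_units_int_smul, map_units_int_smul, S.parityInvolution_of_mem (hT j b hb), smul_smul,
      uzpow_add, ← _root_.mul_assoc, Int.units_mul_self, _root_.one_mul, Units.smul_def,
      Units.smul_def, LinearMap.smul_apply]
  simp only [superBracket, LinearMap.mk₂_apply, conj]
  obtain rfl | rfl := zmod_two_eq_zero_or_one i
  · simp [gradedProj_of_mem S.internal ha]
  · simp [gradedProj_of_mem S.internal ha, Units.smul_def]

theorem superBracket_parity {δ i : ZMod 2} {T : Module.End K A} {a : A}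
    (hT : HasOperatorParity 𝒜 δ T) (ha : a ∈ 𝒜 i) :
    HasOperatorParity 𝒜 (δ + i) (S.superBracket T a) := by
  intro j b hb
  rw [S.superBracket_apply hT ha]
  refine sub_mem ?_ ?_
  · convert hT _ _ (S.mul_mem _ _ _ _ ha hb) using 2; ring
  · rw [Units.smul_def]
    refine zsmul_mem ?_ _
    convert S.mul_mem _ _ _ _ ha (hT _ _ hb) using 2; ring

/-- By the super Jacobi identity the difference of the two sides is `[T, [a, b]]`, and left
multiplications supercommute. -/
theorem superBracket_swap {δ i j : ZMod 2} {T : Module.End K A} {a b : A}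
    (hT : HasOperatorParity 𝒜 δ T) (ha : a ∈ 𝒜 i) (hb : b ∈ 𝒜 j) :
    S.superBracket (S.superBracket T a) b
      = ((-1 : ℤˣ) ^ (i * j)) • S.superBracket (S.superBracket T b) a := by
  ext c
  rw [Units.smul_def, LinearMap.smul_apply, ← Units.smul_def,
    S.superBracket_apply (S.superBracket_parity hT ha) hb,
    S.superBracket_apply (S.superBracket_parity hT hb) ha, S.superBracket_apply hT ha,
    S.superBracket_apply hT hb, S.superBracket_apply hT ha, S.superBracket_apply hT hb,
    S.mul_left_comm ha hb, map_units_int_smul]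
  simp only [map_sub, map_units_int_smul]
  rw [S.mul_left_comm ha hb]
  simp only [add_mul, uzpow_add]
  rw [_root_.mul_comm j i]
  rcases Int.units_eq_one_or ((-1 : ℤˣ) ^ (i * j)) with h1 | h1 <;>
  rcases Int.units_eq_one_or ((-1 : ℤˣ) ^ (δ * i)) with h2 | h2 <;>
  rcases Int.units_eq_one_or ((-1 : ℤˣ) ^ (δ * j)) with h3 | h3 <;>
  simp [h1, h2, h3] <;> abel

/-- The two terms in which `a` stands between `T₁` and `T₂` cancel. This superderivation rule drives
the induction in `nestedSum_supercommutator`. -/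
theorem superBracket_mul {δ₁ δ₂ i : ZMod 2} {T₁ T₂ : Module.End K A} {a : A}
    (h₁ : HasOperatorParity 𝒜 δ₁ T₁) (h₂ : HasOperatorParity 𝒜 δ₂ T₂) (ha : a ∈ 𝒜 i) :
    S.superBracket (T₁ * T₂) a
      = T₁ * S.superBracket T₂ a + ((-1 : ℤˣ) ^ (i * δ₂)) • (S.superBracket T₁ a * T₂) := by
  have h : HasOperatorParity 𝒜 (δ₁ + δ₂) (T₁ * T₂) := fun j b hb => by
    have := h₁ _ _ (h₂ _ _ hb)
    rwa [add_assoc, add_comm δ₂] at this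
  ext b
  rw [S.superBracket_apply h ha, LinearMap.add_apply, Units.smul_def, LinearMap.smul_apply,
    ← Units.smul_def]
  simp only [Module.End.mul_apply]
  rw [S.superBracket_apply h₁ ha, S.superBracket_apply h₂ ha]
  simp only [map_sub, map_units_int_smul, add_mul, uzpow_add, smul_sub, smul_smul]
  rw [_root_.mul_comm i δ₂, _root_.mul_comm ((-1 : ℤˣ) ^ (δ₂ * i))]
  abel

/-- `listForm [a₁, …, aₙ] T = [⋯[T, a₁], …, aₙ] 1`. -/
def listForm : List A → Module.End K A →ₗ[K] A
  | [] => LinearMap.applyₗ S.one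
  | a :: l => listForm l ∘ₗ S.superBracket.flip a

@[simp] theorem listForm_nil (T : Module.End K A) : S.listForm [] T = T S.one := rfl

@[simp] theorem listForm_cons (a : A) (l : List A) (T : Module.End K A) :
    S.listForm (a :: l) T = S.listForm l (S.superBracket T a) := rfl

theorem listForm_swap {δ i j : ZMod 2} {T : Module.End K A} {a b : A}
    (hT : HasOperatorParity 𝒜 δ T) (ha : a ∈ 𝒜 i) (hb : b ∈ 𝒜 j) (l : List A) :
    S.listForm (a :: b :: l) T = ((-1 : ℤˣ) ^ (i * j)) • S.listForm (b :: a :: l) T := by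
  simp only [listForm_cons]
  rw [S.superBracket_swap hT ha hb, map_units_int_smul]

theorem listForm_mem {ι : Type*} {d : ι → ZMod 2} {x : ι → A} (hx : ∀ i, x i ∈ 𝒜 (d i))
    (l : List ι) {δ : ZMod 2} {T : Module.End K A} (hT : HasOperatorParity 𝒜 δ T) :
    S.listForm (l.map x) T ∈ 𝒜 (δ + (l.map d).sum) := by
  induction l generalizing δ T with
  | nil =>
    have := hT 0 S.one S.one_mem
    simpa using this
  | cons i l ih =>
    have := ih (S.superBracket_parity hT (hx i))
    simpa [add_assoc] using this

end SupercommutativeAlgebra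

/-- The signed sum of `G S R` over all splittings of a list `l` of elements of parities `d` into
complementary sublists `S`, `R`. -/
def splitSum {ι M : Type*} [AddCommGroup M] (d : ι → ZMod 2) :
    (List ι → List ι → M) → List ι → M
  | G, [] => G [] []
  | G, i :: l => splitSum d (fun S R => G (i :: S) R) l
      -- Sending the head to the second block costs moving it past the whole first block.
      + splitSum d (fun S R => ((-1 : ℤˣ) ^ (d i * (S.map d).sum)) • G S (i :: R)) l

theorem splitSum_smul {ι M : Type*} [AddCommGroup M] (d : ι → ZMod 2) (s : ℤˣ)
    (G : List ι → List ι → M) (l : List ι) :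
    splitSum d (fun S R => s • G S R) l = s • splitSum d G l := by
  induction l generalizing G with
  | nil => rfl
  | cons i l ih =>
    simp only [splitSum, smul_add, ← ih]
    simp only [smul_smul, mul_comm]

/-! ### The polarized Jacobi identity -/

namespace SupercommutativeAlgebra

variable {K A : Type*} [Field K] [AddCommGroup A] [Module K A] {𝒜 : ZMod 2 → Submodule K A}
  (S : SupercommutativeAlgebra K A 𝒜)

/-- The sum over all splittings of the composite of the forms of two operators. -/
def nestedSum {ι : Type*} (d : ι → ZMod 2) (x : ι → A) (T₁ T₂ : Module.End K A) (l : List ι) : A :=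
  splitSum d (fun P R => S.listForm (S.listForm (P.map x) T₂ :: R.map x) T₁) l

variable {ι : Type*} {d : ι → ZMod 2} {x : ι → A}

/-- A letter in the inner block is absorbed by `T₂`. A letter in the outer block must first pass the
inner value, of parity `δ₂ + |P|`; the `|P|` part cancels the splitting sign, so the remaining sign
does not depend on the splitting. -/
theorem nestedSum_cons (hx : ∀ i, x i ∈ 𝒜 (d i)) {δ₁ δ₂ : ZMod 2} {T₁ T₂ : Module.End K A}
    (h₁ : HasOperatorParity 𝒜 δ₁ T₁) (h₂ : HasOperatorParity 𝒜 δ₂ T₂) (i : ι) (l : List ι) :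
    S.nestedSum d x T₁ T₂ (i :: l) = S.nestedSum d x T₁ (S.superBracket T₂ (x i)) l
      + ((-1 : ℤˣ) ^ (d i * δ₂)) • S.nestedSum d x (S.superBracket T₁ (x i)) T₂ l := by
  unfold nestedSum
  rw [splitSum, ← splitSum_smul]
  congr 2
  funext P R
  rw [List.map_cons, S.listForm_swap h₁ (S.listForm_mem hx P h₂) (hx i), smul_smul]
  rw [S.listForm_cons (x i)]
  congr 1
  rw [← uzpow_add]
  generalize d i = a
  generalize (P.map d).sum = b
  clear * -
  revert a b δ₂
  decide

/-- Peeling off a letter attaches it to `T₁` or `T₂`, as the derivation rule does on the right. With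
no letters left, the extra products of `T₁ 1` and `T₂ 1` cancel by supercommutativity. -/
theorem nestedSum_supercommutator (hx : ∀ i, x i ∈ 𝒜 (d i)) (l : List ι) {δ₁ δ₂ : ZMod 2}
    {T₁ T₂ : Module.End K A} (h₁ : HasOperatorParity 𝒜 δ₁ T₁) (h₂ : HasOperatorParity 𝒜 δ₂ T₂) :
    S.nestedSum d x T₁ T₂ l - ((-1 : ℤˣ) ^ (δ₁ * δ₂)) • S.nestedSum d x T₂ T₁ l
      = S.listForm (l.map x) (T₁ * T₂ - ((-1 : ℤˣ) ^ (δ₁ * δ₂)) • (T₂ * T₁)) := by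
  induction l generalizing δ₁ δ₂ T₁ T₂ with
  | nil =>
    have m₁ : T₁ S.one ∈ 𝒜 δ₁ := by simpa using h₁ _ _ S.one_mem
    have m₂ : T₂ S.one ∈ 𝒜 δ₂ := by simpa using h₂ _ _ S.one_mem
    simp only [nestedSum, splitSum, List.map_nil, listForm_cons, listForm_nil]
    rw [S.superBracket_apply h₁ m₂, S.superBracket_apply h₂ m₁, S.mul_one, S.mul_one,
      S.mul_comm _ _ _ _ m₁ m₂, LinearMap.sub_apply, Units.smul_def ((-1 : ℤˣ) ^ (δ₁ * δ₂))
      (T₂ * T₁), LinearMap.smul_apply, ← Units.smul_def, _root_.mul_comm δ₂ δ₁]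
    simp only [Module.End.mul_apply]
    rcases Int.units_eq_one_or ((-1 : ℤˣ) ^ (δ₁ * δ₂)) with h | h <;> simp [h]
    abel
  | cons i l ih =>
    have b₁ := S.superBracket_parity h₁ (hx i)
    have b₂ := S.superBracket_parity h₂ (hx i)
    have e₁ := ih h₁ b₂
    have e₂ := ih b₁ h₂
    rw [S.nestedSum_cons hx h₁ h₂, S.nestedSum_cons hx h₂ h₁, List.map_cons, listForm_cons,
      map_sub, LinearMap.sub_apply, map_units_int_smul, Units.smul_def _ (S.superBracket _),
      LinearMap.smul_apply, ← Units.smul_def, S.superBracket_mul h₁ h₂ (hx i),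
      S.superBracket_mul h₂ h₁ (hx i)]
    simp only [map_sub, map_add, map_units_int_smul] at e₁ e₂ ⊢
    rw [sub_eq_iff_eq_add] at e₁ e₂
    rw [e₁, e₂]
    simp only [mul_add, add_mul, uzpow_add, _root_.mul_comm (d i)]
    rcases Int.units_eq_one_or ((-1 : ℤˣ) ^ (δ₁ * δ₂)) with h1 | h1 <;>
    rcases Int.units_eq_one_or ((-1 : ℤˣ) ^ (δ₁ * d i)) with h2 | h2 <;>
    rcases Int.units_eq_one_or ((-1 : ℤˣ) ^ (δ₂ * d i)) with h3 | h3 <;>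
    simp [h1, h2, h3] <;> abel

theorem nestedSum_self_eq_zero [CharZero K] (hx : ∀ i, x i ∈ 𝒜 (d i)) {T : Module.End K A}
    (hT : HasOperatorParity 𝒜 1 T) (hsq : ∀ a, T (T a) = 0) (l : List ι) :
    S.nestedSum d x T T l = 0 := by
  have h := S.nestedSum_supercommutator hx l hT hT
  have hTT : T * T = 0 := LinearMap.ext hsq
  have h1 : (-1 : ℤˣ) ^ ((1 : ZMod 2) * 1) = -1 := by decide
  rw [hTT, h1] at h
  simp only [Units.neg_smul, one_smul, sub_neg_eq_add, add_zero, map_zero] at h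
  have h2 : (2 : K) • S.nestedSum d x T T l = 0 := by rw [two_smul, h]
  simpa using h2

end SupercommutativeAlgebra

/-! ### Koszul signs of lists, and unshuffles as splittings -/

section ListSign

variable {ι : Type*} [LinearOrder ι]

/-- The sign contributed by a letter `i` standing to the left of a letter `j`. -/
def pairSign (d : ι → ZMod 2) (i j : ι) : ℤˣ := if j < i then (-1) ^ (d i * d j) else 1

/-- The Koszul sign of sorting a word. -/
def listSign (d : ι → ZMod 2) : List ι → ℤˣ
  | [] => 1
  | i :: l => (l.map (pairSign d i)).prod * listSign d l

theorem pairSign_mul_pairSign (d : ι → ZMod 2) {i j : ι} (h : i ≠ j) :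
    pairSign d i j * pairSign d j i = (-1) ^ (d i * d j) := by
  rcases lt_or_gt_of_ne h with h | h
  · simp [pairSign, h, h.le, mul_comm]
  · simp [pairSign, h, h.le]

theorem listSign_ofFn (d : ι → ZMod 2) {n : ℕ} (f : Fin n → ι) :
    listSign d (List.ofFn f) =
      ∏ p : Fin n × Fin n with p.1 < p.2 ∧ f p.2 < f p.1, (-1 : ℤˣ) ^ (d (f p.1) * d (f p.2)) := by
  rw [Finset.prod_filter, Fintype.prod_prod_type]
  induction n with
  | zero => simp [listSign]
  | succ n ih =>
    rw [List.ofFn_succ, listSign, ih, Fin.prod_univ_succ]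
    simp only [Fin.prod_univ_succ, Fin.succ_lt_succ_iff, Fin.succ_pos, true_and, lt_self_iff_false,
      false_and, if_false, one_mul, Fin.not_lt_zero]
    rw [List.map_ofFn, List.prod_ofFn]
    rfl

theorem koszulSign_eq_listSign {n : ℕ} (σ : Equiv.Perm (Fin n)) (d : Fin n → ZMod 2) :
    koszulSign σ d = listSign d (List.ofFn σ) :=
  (listSign_ofFn d σ).symm

theorem prod_map_pairSign_of_forall_lt (d : ι → ZMod 2) {i : ι} {l : List ι}
    (h : ∀ j ∈ l, i < j) : (l.map (pairSign d i)).prod = 1 := by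
  refine List.prod_eq_one fun s hs => ?_
  obtain ⟨j, hj, rfl⟩ := List.mem_map.mp hs
  simp [pairSign, (h j hj).le]

theorem listSign_of_pairwise_lt (d : ι → ZMod 2) {l : List ι} (h : l.Pairwise (· < ·)) :
    listSign d l = 1 := by
  induction h with
  | nil => rfl
  | cons h _ ih => rw [listSign, ih, prod_map_pairSign_of_forall_lt d h, one_mul]

theorem listSign_append_cons (d : ι → ZMod 2) {i : ι} (l l' : List ι) (h : ∀ j ∈ l, i < j)
    (h' : ∀ j ∈ l', i < j) :
    listSign d (l ++ i :: l') = (-1) ^ (d i * (l.map d).sum) * listSign d (l ++ l') := by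
  induction l with
  | nil => simp [listSign, prod_map_pairSign_of_forall_lt d h']
  | cons j l ih =>
    have hj : pairSign d j i = (-1) ^ (d i * d j) := by
      rw [pairSign, if_pos (h j (by simp)), mul_comm]
    simp only [List.cons_append, listSign, List.map_append, List.map_cons, List.prod_append,
      List.prod_cons, List.sum_cons, mul_add, uzpow_add]
    rw [ih fun k hk => h k (by simp [hk]), hj]
    ac_rfl

/-- A splitting is the choice of the subset forming the first block. As the head is the smallest
letter, it costs nothing in front, and in the second block exactly its passage across the first; so
the recursive signs build up the sorting sign of the concatenation. -/
theorem splitSum_eq_sum_powerset {M : Type*} [AddCommGroup M] (d : ι → ZMod 2)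
    (G : List ι → List ι → M) {l : List ι} (hl : l.Pairwise (· < ·)) :
    splitSum d G l = ∑ P ∈ l.toFinset.powerset,
      listSign d (l.filter (· ∈ P) ++ l.filter (· ∉ P)) •
        G (l.filter (· ∈ P)) (l.filter (· ∉ P)) := by
  induction hl generalizing G with
  | nil => simp [splitSum, listSign]
  | @cons i l hi _ ih =>
    have hil : i ∉ l := fun h => lt_irrefl i (hi i h)
    rw [List.toFinset_cons, Finset.sum_powerset_insert (by simpa using hil), splitSum, ih, ih,
      add_comm]
    have lt_filter (p : ι → Bool) : ∀ j ∈ l.filter p, i < j :=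
      fun j hj => hi j (List.mem_of_mem_filter hj)
    congr 1
    · refine Finset.sum_congr rfl fun P hP => ?_
      have hiP : i ∉ P := fun h => hil (by simpa using Finset.mem_powerset.mp hP h)
      rw [List.filter_cons_of_neg (by simpa using hiP), List.filter_cons_of_pos (by simpa using hiP),
        listSign_append_cons d _ _ (lt_filter _) (lt_filter _), smul_smul, mul_comm]
    · refine Finset.sum_congr rfl fun P _ => ?_
      have e₁ : l.filter (· ∈ insert i P) = l.filter (· ∈ P) :=
        List.filter_congr fun j hj => by simp [(hi j hj).ne']
      have e₂ : l.filter (· ∉ insert i P) = l.filter (· ∉ P) :=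
        List.filter_congr fun j hj => by simp [(hi j hj).ne']
      rw [List.filter_cons_of_pos (by simp), List.filter_cons_of_neg (by simp), e₁, e₂,
        List.cons_append, listSign, prod_map_pairSign_of_forall_lt d fun j hj => ?_, one_mul]
      rcases List.mem_append.mp hj with hj | hj <;> exact lt_filter _ j hj

end ListSign

section Unshuffle

variable {r : ℕ}

theorem ofFn_append_ofFn_eq {α : Type*} {k : ℕ} (hk : k ≤ r) (f : Fin r → α) :
    List.ofFn (fun i : Fin k => f (Fin.castLE hk i)) ++
      List.ofFn (fun j : Fin (r - k) => f ⟨k + j, by omega⟩) = List.ofFn f := by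
  refine List.ext_getElem (by simp; omega) fun i h₁ h₂ => ?_
  rw [List.getElem_append]
  split_ifs with h
  · simp
  · simp only [List.getElem_ofFn, List.length_ofFn]
    congr 2
    simp at h
    omega

theorem IsUnshuffle.pairwise_left {k : ℕ} (hk : k ≤ r) {σ : Equiv.Perm (Fin r)}
    (h : IsUnshuffle k σ) :
    (List.ofFn fun i : Fin k => σ (Fin.castLE hk i)).Pairwise (· < ·) :=
  List.pairwise_ofFn.mpr fun i j hij => h.1 _ _ (by simpa using hij) (by simp)

theorem IsUnshuffle.pairwise_right {k : ℕ} {σ : Equiv.Perm (Fin r)}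
    (h : IsUnshuffle k σ) :
    (List.ofFn fun j : Fin (r - k) => σ ⟨k + j, by omega⟩).Pairwise (· < ·) :=
  List.pairwise_ofFn.mpr fun i j hij => h.2 _ _ (by simpa using hij) (by simp)

theorem finRange_filter_eq {l : List (Fin r)} (hl : l.Pairwise (· < ·)) {p : Fin r → Bool}
    (hp : ∀ i, p i ↔ i ∈ l) : (List.finRange r).filter p = l := by
  refine List.Perm.eq_of_pairwise (le := (· < ·)) (fun a b _ _ h h' => absurd h h'.asymm)
    ((List.pairwise_lt_finRange r).filter _) hl ?_
  rw [List.perm_ext_iff_of_nodup ((List.nodup_finRange r).filter _) (hl.imp ne_of_lt)]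
  intro i
  simp [← hp]

/-- An increasing list is determined by its set of entries, so an unshuffle is recovered from the
values in its first block. -/
theorem filter_mem_of_append_eq {l l' : List (Fin r)} {σ : Equiv.Perm (Fin r)}
    (h : l ++ l' = List.ofFn σ) (hl : l.Pairwise (· < ·)) (hl' : l'.Pairwise (· < ·)) :
    (List.finRange r).filter (· ∈ l.toFinset) = l ∧
      (List.finRange r).filter (· ∉ l.toFinset) = l' := by
  have nodup : (l ++ l').Nodup := h ▸ List.nodup_ofFn.mpr σ.injective
  have mem (i : Fin r) : i ∈ l ++ l' := by
    rw [h, List.mem_ofFn]; exact σ.surjective i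
  refine ⟨finRange_filter_eq hl (by simp), finRange_filter_eq hl' fun i => ?_⟩
  have h₁ := mem i
  rw [List.mem_append] at h₁
  have h₂ := List.disjoint_of_nodup_append nodup (a := i)
  simp only [List.mem_toFinset, decide_eq_true_eq]
  tauto

theorem exists_perm_ofFn_eq {l : List (Fin r)} (hl : l.Nodup) (hr : l.length = r) :
    ∃ σ : Equiv.Perm (Fin r), List.ofFn σ = l := by
  have inj : Function.Injective fun i : Fin r => l[(i : ℕ)]'(by omega) := fun i j hij =>
    Fin.ext ((List.Nodup.getElem_inj_iff hl).mp hij)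
  refine ⟨Equiv.ofBijective _ (Finite.injective_iff_bijective.mp inj), ?_⟩
  exact List.ext_getElem (by simp [hr]) fun i h₁ h₂ => by simp

theorem splitSum_finRange {M : Type*} [AddCommGroup M] (d : Fin r → ZMod 2)
    (G : List (Fin r) → List (Fin r) → M) :
    splitSum d G (List.finRange r) = G [] (List.finRange r) +
      ∑ k : Fin r, ∑ σ : Equiv.Perm (Fin r) with IsUnshuffle ((k : ℕ) + 1) σ,
        koszulSign σ d •
          G (List.ofFn fun i => σ (Fin.castLE (Nat.succ_le_of_lt k.2) i))
            (List.ofFn fun j : Fin (r - ((k : ℕ) + 1)) => σ ⟨(k : ℕ) + 1 + (j : ℕ), by omega⟩) := by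
  have univ_eq : (List.finRange r).toFinset = Finset.univ := by ext; simp
  rw [splitSum_eq_sum_powerset d G (List.pairwise_lt_finRange r), univ_eq, Finset.powerset_univ,
    -- The empty first block matches no `k + 1 ≥ 1`, so it is split off.
    ← Finset.add_sum_erase _ _ (Finset.mem_univ ∅)]
  congr 1
  · simp [listSign_of_pairwise_lt d (List.pairwise_lt_finRange r)]
  symm
  rw [Finset.sum_sigma']
  refine Finset.sum_bij
    (fun p _ => (List.ofFn fun i => p.2 (Fin.castLE (Nat.succ_le_of_lt p.1.2) i)).toFinset)
    ?_ ?_ ?_ ?_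
  · rintro ⟨k, σ⟩ -
    simp
  · rintro ⟨k, σ⟩ h ⟨k', σ'⟩ h' e
    simp only [Finset.mem_sigma, Finset.mem_univ, Finset.mem_filter, true_and] at h h' e
    have f := filter_mem_of_append_eq (ofFn_append_ofFn_eq (Nat.succ_le_of_lt k.2) σ)
      (h.pairwise_left _) h.pairwise_right
    have f' := filter_mem_of_append_eq (ofFn_append_ofFn_eq (Nat.succ_le_of_lt k'.2) σ')
      (h'.pairwise_left _) h'.pairwise_right
    rw [← e] at f'
    have e₁ := f.1.symm.trans f'.1
    have e₂ := f.2.symm.trans f'.2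
    have hk : k = k' := by
      have := congrArg List.length e₁
      simp at this
      exact Fin.ext this
    have hσ : List.ofFn σ = List.ofFn σ' := by
      rw [← ofFn_append_ofFn_eq (Nat.succ_le_of_lt k.2) σ, e₁, e₂, ofFn_append_ofFn_eq]
    subst hk
    congr
    exact DFunLike.coe_injective (List.ofFn_injective hσ)
  -- The preimage lists `P` increasingly, then its complement; `P` nonempty makes `k = |P| - 1`
  -- legitimate.
  · intro P hP
    obtain ⟨hP, -⟩ := Finset.mem_erase.mp hP
    set A := (List.finRange r).filter (· ∈ P) with hA
    set B := (List.finRange r).filter (· ∉ P) with hB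
    have pA : A.Pairwise (· < ·) := (List.pairwise_lt_finRange r).filter _
    have pB : B.Pairwise (· < ·) := (List.pairwise_lt_finRange r).filter _
    have memA (i : Fin r) : i ∈ A ↔ i ∈ P := by simp [hA]
    have memB (i : Fin r) : i ∈ B ↔ i ∉ P := by simp [hB]
    have nodup : (A ++ B).Nodup := List.Nodup.append (pA.imp ne_of_lt) (pB.imp ne_of_lt)
      fun i h h' => (memB i).mp h' ((memA i).mp h)
    have length : (A ++ B).length = r := by
      have : (A ++ B).toFinset = Finset.univ := by
        ext i; simp [memA, memB, em]
      rw [← List.toFinset_card_of_nodup nodup, this, Finset.card_univ, Fintype.card_fin]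
    obtain ⟨σ, hσ⟩ := exists_perm_ofFn_eq nodup length
    have Apos : 0 < A.length := by
      obtain ⟨i, hi⟩ := Finset.nonempty_iff_ne_empty.mpr hP
      exact List.length_pos_of_mem ((memA i).mpr hi)
    have hlen : A.length - 1 < r := by rw [List.length_append] at length; omega
    have hσA : ∀ (i : Fin r) (h : (i : ℕ) < A.length), σ i = A[(i : ℕ)] := fun i h => by
      have : (List.ofFn σ)[(i : ℕ)]'(by simp) = (A ++ B)[(i : ℕ)]'(by omega) := by simp [hσ]
      rw [List.getElem_ofFn, List.getElem_append_left h] at this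
      exact this
    have hσB : ∀ (i : Fin r) (h : A.length ≤ (i : ℕ)),
        σ i = B[(i : ℕ) - A.length]'(by rw [List.length_append] at length; omega) := fun i h => by
      have : (List.ofFn σ)[(i : ℕ)]'(by simp) = (A ++ B)[(i : ℕ)]'(by omega) := by simp [hσ]
      rw [List.getElem_ofFn, List.getElem_append_right h] at this
      exact this
    refine ⟨⟨⟨A.length - 1, hlen⟩, σ⟩, ?_, ?_⟩
    · simp only [Finset.mem_sigma, Finset.mem_univ, Finset.mem_filter, true_and]
      rw [Nat.sub_add_cancel Apos]
      refine ⟨fun i j hij hj => ?_, fun i j hij hi => ?_⟩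
      · rw [hσA i (lt_trans hij hj), hσA j hj]
        exact List.pairwise_iff_getElem.mp pA _ _ _ _ hij
      · have hj : A.length ≤ (j : ℕ) := le_trans hi (le_of_lt hij)
        rw [hσB i hi, hσB j hj]
        exact List.pairwise_iff_getElem.mp pB _ _ _ _ (by have : (i : ℕ) < j := hij; omega)
    · have : (List.ofFn fun i : Fin (A.length - 1 + 1) =>
          σ (Fin.castLE (Nat.succ_le_of_lt hlen) i)) = A := by
        refine List.ext_getElem (by simp; omega) fun i h₁ h₂ => ?_
        rw [List.getElem_ofFn, hσA _ h₂]
        rfl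
      ext i
      rw [this, List.mem_toFinset, memA]
  · rintro ⟨k, σ⟩ h
    simp only [Finset.mem_sigma, Finset.mem_univ, Finset.mem_filter, true_and] at h
    have f := filter_mem_of_append_eq (ofFn_append_ofFn_eq (Nat.succ_le_of_lt k.2) σ)
      (h.pairwise_left _) h.pairwise_right
    dsimp only
    rw [f.1, f.2, ofFn_append_ofFn_eq, koszulSign_eq_listSign]

end Unshuffle

/-! ### Graded symmetry and the `L∞` algebra of an operator -/

namespace SupercommutativeAlgebra

variable {K A : Type*} [Field K] [AddCommGroup A] [Module K A] {𝒜 : ZMod 2 → Submodule K A}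
  (S : SupercommutativeAlgebra K A 𝒜)

/-- Keeping a sorting sign on each side makes the claim transitive, so adjacent swaps suffice.
Distinct letters are needed: `pairSign` is `1` on equal letters, while swapping two equal odd ones
gives `-1`. -/
theorem listForm_perm {ι : Type*} [LinearOrder ι] {d : ι → ZMod 2} {x : ι → A}
    (hx : ∀ i, x i ∈ 𝒜 (d i)) {l l' : List ι} (h : l.Perm l') (hl : l.Nodup) {δ : ZMod 2}
    {T : Module.End K A} (hT : HasOperatorParity 𝒜 δ T) :
    listSign d l • S.listForm (l.map x) T = listSign d l' • S.listForm (l'.map x) T := by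
  induction h generalizing δ T with
  | nil => rfl
  | cons i h ih =>
    have := ih hl.of_cons (S.superBracket_parity hT (hx i))
    simp only [listSign, List.map_cons, listForm_cons, mul_smul, this]
    rw [(h.map _).prod_eq]
  | swap i j l =>
    have hij : i ≠ j := by
      rintro rfl
      simp at hl
    simp only [List.map_cons]
    rw [S.listForm_swap hT (hx j) (hx i), smul_smul]
    congr 1
    have := pairSign_mul_pairSign d hij
    simp only [listSign, List.map_cons, List.prod_cons]
    rw [_root_.mul_comm (d j), ← this]
    have hs := Int.units_mul_self (pairSign d j i)
    calc _ = (pairSign d j i * pairSign d j i) * (pairSign d i j * (l.map (pairSign d i)).prod *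
          ((l.map (pairSign d j)).prod * listSign d l)) := by ac_rfl
      _ = _ := by rw [hs, _root_.one_mul]
  | trans h _ ih ih' => exact (ih hl hT).trans (ih' (h.nodup hl) hT)

/-- The multilinear form `(a₁, …, aₙ) ↦ [⋯[T, a₁], …, aₙ] 1`, linear in `T`. -/
def multilinearForm : (n : ℕ) → Module.End K A →ₗ[K] MultilinearMap K (fun _ : Fin n => A) A
  | 0 => (MultilinearMap.constLinearEquivOfIsEmpty K K (fun _ : Fin 0 => A) A).toLinearMap ∘ₗ
      LinearMap.applyₗ S.one
  | n + 1 => (multilinearCurryLeftEquiv K (fun _ : Fin (n + 1) => A) A).symm.toLinearMap ∘ₗ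
      (LinearMap.compRight K (multilinearForm n)) ∘ₗ S.superBracket

theorem multilinearForm_apply (n : ℕ) (T : Module.End K A) (a : Fin n → A) :
    S.multilinearForm n T a = S.listForm (List.ofFn a) T := by
  induction n generalizing T with
  | zero => rfl
  | succ n ih =>
    rw [List.ofFn_succ, listForm_cons, ← ih]
    rfl

/-- The `L∞` algebra of the higher brackets of an odd square-zero operator that kills the unit. -/
def lInfinity [CharZero K] {T : Module.End K A} (hT : HasOperatorParity 𝒜 1 T)
    (hsq : ∀ a, T (T a) = 0) (hone : T S.one = 0) : LInfinityAlgebra K A 𝒜 where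
  grading := S.internal
  bracket n := S.multilinearForm n T
  bracket_zero := by
    ext a
    rw [S.multilinearForm_apply]
    simp [hone]
  odd n d a ha := by
    have := S.listForm_mem ha (List.ofFn id) hT
    rw [List.map_ofFn, List.map_ofFn, List.sum_ofFn] at this
    rw [S.multilinearForm_apply]
    exact this
  symm n σ d a ha := by
    have h := S.listForm_perm ha (l := List.ofFn σ) (l' := List.finRange n)
      (by
        rw [List.perm_ext_iff_of_nodup (List.nodup_ofFn.mpr σ.injective) (List.nodup_finRange n)]
        intro i
        simpa using σ.surjective i)
      (List.nodup_ofFn.mpr σ.injective) hT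
    rw [listSign_of_pairwise_lt d (List.pairwise_lt_finRange n), one_smul, List.map_ofFn,
      ← List.ofFn_id, List.map_ofFn, ← koszulSign_eq_listSign] at h
    rw [S.multilinearForm_apply, S.multilinearForm_apply]
    change _ = koszulSign σ d • S.listForm (List.ofFn (a ∘ id)) T
    rw [← h, smul_smul, Int.units_mul_self, one_smul]
    rfl
  jacobi r d a ha := by
    have h := S.nestedSum_self_eq_zero ha hT hsq (List.finRange r)
    rw [nestedSum, splitSum_finRange] at h
    -- The splitting with empty inner block inserts `T 1 = 0` and drops out.
    simp only [List.map_nil, listForm_nil, hone, listForm_cons, map_zero, zero_add] at h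
    rw [← h]
    refine Finset.sum_congr rfl fun k _ => Finset.sum_congr rfl fun σ _ => ?_
    rw [S.multilinearForm_apply, S.multilinearForm_apply, List.ofFn_cons, listForm_cons,
      List.map_ofFn, List.map_ofFn]
    rfl

end SupercommutativeAlgebra

/-! ### The forms `Φ` -/

theorem snoc_apply_zero {X : Type*} {n : ℕ} (p : Fin (n + 1) → X) (x : X) :
    Fin.snoc (α := fun _ => X) p x 0 = p 0 :=
  Fin.snoc_castSucc (α := fun _ => X) x p 0

theorem snoc_apply_succ {X : Type*} {n : ℕ} (p : Fin (n + 1) → X) (x : X) :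
    (fun i : Fin (n + 1) => Fin.snoc (α := fun _ => X) p x i.succ)
      = Fin.snoc (α := fun _ => X) (fun i => p i.succ) x := by
  funext i
  refine Fin.lastCases ?_ (fun i => ?_) i
  · rw [Fin.succ_last, Fin.snoc_last, Fin.snoc_last]
  · rw [Fin.succ_castSucc, Fin.snoc_castSucc, Fin.snoc_castSucc]

section Phi

variable {K A B : Type*} [Field K] [AddCommGroup A] [Module K A] [AddCommGroup B] [Module K B]

/-- Applied to the inclusion of the closed elements into `V` and to their projection onto
cohomology, this yields both closedness and descent of `Φ`. -/
theorem Phi_map {m : A →ₗ[K] A →ₗ[K] A} {e : A} {T : Module.End K A} {m' : B →ₗ[K] B →ₗ[K] B}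
    {e' : B} {T' : Module.End K B} (f : A →ₗ[K] B) (hm : ∀ a b, f (m a b) = m' (f a) (f b))
    (he : f e = e') (hT : ∀ a, f (T a) = T' (f a)) (δ : ZMod 2) (r : ℕ) (d : Fin (r + 1) → ZMod 2)
    (a : Fin (r + 1) → A) :
    f (Phi m e T δ r d a) = Phi m' e' T' δ r d (fun i => f (a i)) := by
  induction r with
  | zero => simp [Phi, hm, hT, he]
  | succ r ih =>
    have snoc (p : Fin r → A) (x : A) : (fun i => f (Fin.snoc (α := fun _ => A) p x i))
        = Fin.snoc (α := fun _ => B) (fun i => f (p i)) (f x) := by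
      funext i
      refine Fin.lastCases ?_ (fun i => ?_) i <;> simp
    simp only [Phi, map_sub, map_units_int_smul, hm, ih, snoc]

theorem Phi_add (m : A →ₗ[K] A →ₗ[K] A) (e : A) (T T' : Module.End K A) (δ : ZMod 2) (r : ℕ)
    (d : Fin (r + 1) → ZMod 2) (a : Fin (r + 1) → A) :
    Phi m e (T + T') δ r d a = Phi m e T δ r d a + Phi m e T' δ r d a := by
  induction r with
  | zero => simp [Phi]; abel
  | succ r ih =>
    simp only [Phi, ih, map_add, LinearMap.add_apply, smul_add]
    abel

theorem Phi_zero_operator (m : A →ₗ[K] A →ₗ[K] A) (e : A) (δ : ZMod 2) (r : ℕ)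
    (d : Fin (r + 1) → ZMod 2) (a : Fin (r + 1) → A) : Phi m e 0 δ r d a = 0 := by
  have h := Phi_add m e 0 0 δ r d a
  simpa using h

theorem Phi_sum_eq_zero {ι : Type*} (s : Finset ι) (m : A →ₗ[K] A →ₗ[K] A) (e : A)
    (T : ι → Module.End K A) (δ : ZMod 2) (r : ℕ) (d : Fin (r + 1) → ZMod 2) (a : Fin (r + 1) → A)
    (h : ∀ i ∈ s, Phi m e (T i) δ r d a = 0) : Phi m e (∑ i ∈ s, T i) δ r d a = 0 :=
  Finset.sum_induction T (fun T => Phi m e T δ r d a = 0)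
    (fun T T' hT hT' => by rw [Phi_add, hT, hT', add_zero]) (Phi_zero_operator m e δ r d a) h

theorem Phi_nsmul_eq_zero (m : A →ₗ[K] A →ₗ[K] A) (e : A)
    (T : Module.End K A) (δ : ZMod 2) (r : ℕ) (d : Fin (r + 1) → ZMod 2) (a : Fin (r + 1) → A)
    (h : Phi m e T δ r d a = 0) (n : ℕ) : Phi m e (n • T) δ r d a = 0 := by
  rw [← Finset.card_range n, ← Finset.sum_const]
  exact Phi_sum_eq_zero _ _ _ _ _ _ _ _ fun _ _ => h

/-- The operator `b ↦ T (a b) - T(a) b ∓ a T(b)` measuring the failure of `T` to be a derivation. -/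
def derivationDefect (m : A →ₗ[K] A →ₗ[K] A) (T : Module.End K A) (s : ℤˣ) (a : A) :
    Module.End K A :=
  T ∘ₗ m a - m (T a) - s • (m a ∘ₗ T)

theorem derivationDefect_apply (m : A →ₗ[K] A →ₗ[K] A) (T : Module.End K A) (s : ℤˣ) (a b : A) :
    derivationDefect m T s a b = T (m a b) - m (T a) b - s • m a (T b) := by
  simp [derivationDefect, Units.smul_def]

/-- The defining recursion touches only the last two arguments, so peeling off the first commutes
with it. In the base case the defect kills `e`, by the right unit law and `T e = 0`. Commutativity
and associativity play no role. -/
theorem Phi_succ_eq_derivationDefect {m : A →ₗ[K] A →ₗ[K] A} {e : A} {T : Module.End K A}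
    (hT : T e = 0) (he : ∀ a, m a e = a) (δ : ZMod 2) (r : ℕ)
    (d : Fin (r + 2) → ZMod 2) (a : Fin (r + 2) → A) :
    Phi m e T δ (r + 1) d a =
      Phi m e (derivationDefect m T ((-1) ^ (d 0 * δ)) (a 0)) (δ + d 0) r
        (fun i => d i.succ) (fun i => a i.succ) := by
  induction r with
  | zero =>
    simp [Phi, derivationDefect_apply, hT, he, Fin.snoc]
  | succ r ih =>
    rw [Phi]
    conv_rhs => rw [Phi]
    simp only [ih, snoc_apply_zero, snoc_apply_succ, Fin.sum_univ_succ, add_assoc]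
    rfl

end Phi

/-! ### `Φ` as an iterated supercommutator -/

namespace SupercommutativeAlgebra

variable {K A : Type*} [Field K] [AddCommGroup A] [Module K A] {𝒜 : ZMod 2 → Submodule K A}
  (S : SupercommutativeAlgebra K A 𝒜)

theorem superBracket_mul_left_eq_zero {i j : ZMod 2} {a b : A} (ha : a ∈ 𝒜 i) (hb : b ∈ 𝒜 j) :
    S.superBracket (S.mul a) b = 0 := by
  have h : HasOperatorParity 𝒜 i (S.mul a) := fun k c hc => by
    rw [add_comm]; exact S.mul_mem _ _ _ _ ha hc
  ext c
  rw [S.superBracket_apply h hb, S.mul_left_comm ha hb, sub_self, LinearMap.zero_apply]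

/-- The defect of `T` at `a₀` is `[T, a₀]` minus multiplication by `T a₀`; the correction makes it
kill the unit, as the induction needs, and is itself killed by the next bracket. -/
theorem Phi_eq_listForm (r : ℕ) {δ : ZMod 2} {T : Module.End K A} (hT : HasOperatorParity 𝒜 δ T)
    (hone : T S.one = 0) (d : Fin (r + 1) → ZMod 2) (a : Fin (r + 1) → A)
    (ha : ∀ i, a i ∈ 𝒜 (d i)) :
    Phi S.mul S.one T δ r d a = S.listForm (List.ofFn a) T := by
  induction r generalizing δ T with
  | zero =>
    rw [List.ofFn_succ, List.ofFn_zero, listForm_cons, listForm_nil,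
      S.superBracket_apply hT (ha 0), S.mul_one]
    simp [Phi, hone]
  | succ r ih =>
    have key : derivationDefect S.mul T ((-1) ^ (d 0 * δ)) (a 0)
        = S.superBracket T (a 0) - S.mul (T (a 0)) := by
      ext b
      rw [derivationDefect_apply, LinearMap.sub_apply, S.superBracket_apply hT (ha 0),
        _root_.mul_comm (d 0)]
      abel
    have hTa : T (a 0) ∈ 𝒜 (δ + d 0) := by
      rw [add_comm]; exact hT _ _ (ha 0)
    rw [Phi_succ_eq_derivationDefect hone S.mul_one, key, ih, List.ofFn_succ (f := a),
      listForm_cons, map_sub, sub_eq_self, List.ofFn_succ, listForm_cons,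
      S.superBracket_mul_left_eq_zero hTa (ha _), map_zero]
    · intro i b hb
      refine sub_mem (S.superBracket_parity hT (ha 0) i b hb) ?_
      rw [add_comm i]
      exact S.mul_mem _ _ _ _ hTa hb
    · rw [LinearMap.sub_apply, S.superBracket_apply hT (ha 0), hone, S.mul_one, S.mul_one]
      simp
    · exact fun i => ha i.succ

theorem lInfinity_bracket_apply [CharZero K] {T : Module.End K A} (hT : HasOperatorParity 𝒜 1 T)
    (hsq : ∀ a, T (T a) = 0) (hone : T S.one = 0) (r : ℕ) (d : Fin (r + 1) → ZMod 2)
    (a : Fin (r + 1) → A) (ha : ∀ i, a i ∈ 𝒜 (d i)) :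
    (S.lInfinity hT hsq hone).bracket (r + 1) a = Phi S.mul S.one T 1 r d a := by
  rw [S.Phi_eq_listForm r hT hone d a ha, ← S.multilinearForm_apply]
  rfl

end SupercommutativeAlgebra

/-! ### Modes as differential operators -/

namespace VertexOperatorAlgebra

variable {K V : Type*} [Field K] [AddCommGroup V] [Module K V] (D : VertexOperatorAlgebra K V)

theorem wick_one (a : V) : D.wick a D.one = a := D.mode_one_neg_one a

theorem one_wick (a : V) : D.wick D.one a = a := by
  have := D.one_mode (-1) a
  rwa [if_pos rfl] at this

/-- The commutator formula for a nonnegative mode and the Wick product. -/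
theorem mode_wick_sub {i j : ZMod 2} {v a : V} (hv : v ∈ D.parity i) (ha : a ∈ D.parity j)
    (k : ℕ) (c : V) :
    D.mode k v (D.wick a c) - ((-1 : ℤˣ) ^ (i * j)) • D.wick a (D.mode k v c)
      = ∑ s ∈ Finset.range (k + 1), k.choose s • D.mode (k - 1 - s) (D.mode s v a) c := by
  -- With `r = 0` only `s = 0` survives on the right; with `p = k` the left sum stops at `s = k`.
  have h := D.borcherds i j v a c hv ha k (-1) 0
  rw [finsum_eq_sum_of_support_subset (s := Finset.range (k + 1)), finsum_eq_single _ 0] at h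
  · symm
    refine Eq.trans (Finset.sum_congr rfl fun s _ => ?_) (h.trans ?_)
    · rw [Ring.choose_natCast, Nat.cast_smul_eq_nsmul, zero_add, ← sub_eq_add_neg]
      rfl
    · simp
      rfl
  · intro s hs
    obtain ⟨s, rfl⟩ := Nat.exists_eq_succ_of_ne_zero hs
    simp [Ring.choose_zero_succ]
  · intro s hs
    by_contra hs'
    refine hs ?_
    have : k < s := by simpa using hs'
    simp [Ring.choose_natCast, Nat.choose_eq_zero_of_lt this]

/-- The `s = k` term of the commutator formula is the Wick product `(v_k a) c`, which the defect
subtracts. -/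
theorem derivationDefect_mode {i j : ZMod 2} {v a : V} (hv : v ∈ D.parity i) (ha : a ∈ D.parity j)
    (k : ℕ) : derivationDefect D.wick (D.mode k v) ((-1) ^ (j * i)) a
      = ∑ s ∈ Finset.range k, k.choose s • D.mode (k - 1 - s) (D.mode s v a) := by
  ext c
  have h := D.mode_wick_sub hv ha k c
  rw [Finset.sum_range_succ, Nat.choose_self, one_smul, show (k : ℤ) - 1 - k = -1 by ring] at h
  rw [derivationDefect_apply, mul_comm j, sub_right_comm, h, LinearMap.sum_apply]
  exact add_sub_cancel_right _ _

/-- A mode `v_k` with `k ≥ 0` is a differential operator of order at most `k + 1`. -/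
theorem Phi_mode_eq_zero (k r : ℕ) (hkr : k < r) {i : ZMod 2} {v : V} (hv : v ∈ D.parity i)
    (d : Fin (r + 1) → ZMod 2) (a : Fin (r + 1) → V) (ha : ∀ i, a i ∈ D.parity (d i)) :
    Phi D.wick D.one (D.mode k v) i r d a = 0 := by
  induction k using Nat.strong_induction_on generalizing r i v with
  | _ k ih =>
    obtain _ | r := r
    · exact absurd hkr (Nat.not_lt_zero k)
    have hone : D.mode k v D.one = 0 := D.mode_one_nonneg k v (by positivity)
    rw [Phi_succ_eq_derivationDefect hone D.wick_one,
      D.derivationDefect_mode hv (ha 0)]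
    refine Phi_sum_eq_zero _ _ _ _ _ _ _ _ fun s hs => Phi_nsmul_eq_zero _ _ _ _ _ _ _ ?_ _
    have hs' := Finset.mem_range.mp hs
    -- Since `s < k`, the new index is nonnegative and below `k`; for `k = 0` the sum is empty and
    -- `v_0` is a derivation.
    rw [show (k : ℤ) - 1 - s = ((k - 1 - s : ℕ) : ℤ) by omega]
    exact ih _ (by omega) _ (by omega) (D.mode_parity _ _ _ _ _ hv (ha 0)) _ _ fun j => ha j.succ

/-- If an odd operator is a mode, it is the mode of an odd vector. -/
theorem exists_odd_of_mode_eq {T : Module.End K V} (hT : HasOperatorParity D.parity 1 T) {n : ℤ}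
    {v : V} (h : T = D.mode n v) : ∃ w ∈ D.parity 1, T = D.mode n w := by
  refine ⟨gradedProj D.parity_internal 1 v, gradedProj_mem _ _ _, ?_⟩
  refine linearMap_ext_of_isInternal D.parity_internal fun i a ha => ?_
  have e : T a = D.mode n (gradedProj D.parity_internal 0 v) a
      + D.mode n (gradedProj D.parity_internal 1 v) a := by
    rw [h, ← LinearMap.add_apply, ← map_add, gradedProj_zero_add_one]
  have m₀ := D.mode_parity 0 i n _ a (gradedProj_mem D.parity_internal 0 v) ha
  have m₁ := D.mode_parity 1 i n _ a (gradedProj_mem D.parity_internal 1 v) ha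
  have m := hT i a ha
  rw [zero_add] at m₀
  rw [add_comm] at m₁
  have p := congrArg (gradedProj D.parity_internal (i + 1)) e
  rw [map_add, gradedProj_of_mem _ m, if_pos rfl] at p
  erw [gradedProj_of_mem _ m₀, gradedProj_of_mem _ m₁] at p
  rw [if_pos rfl, if_neg (by simp), zero_add] at p
  exact p

end VertexOperatorAlgebra

/-! ### Descent to cohomology -/

namespace DifferentialVOA

variable {K V : Type*} [Field K] [AddCommGroup V] [Module K V] (D : DifferentialVOA K V)

theorem Q_gradedProj (i : ZMod 2) (a : V) :
    D.Q (gradedProj D.parity_internal i a) = gradedProj D.parity_internal (i + 1) (D.Q a) := by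
  have : D.Q ∘ₗ gradedProj D.parity_internal i
      = gradedProj D.parity_internal (i + 1) ∘ₗ D.Q :=
    linearMap_ext_of_isInternal D.parity_internal fun j a ha => by
      simp only [LinearMap.comp_apply, gradedProj_of_mem _ ha,
        gradedProj_of_mem _ (D.Q_odd j a ha), add_left_inj]
      split_ifs <;> simp
  exact congrArg (fun f => f a) this

theorem Q_one [CharZero K] : D.Q D.one = 0 := by
  have h := D.Q_wick 0 D.one D.one D.one_mem.2
  rw [D.wick_one, D.wick_one, D.one_wick, uzpow_zero, one_smul, left_eq_add] at h
  exact h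

theorem Q_wick_of_closed_right (x : V) {b : V} (hb : D.Q b = 0) :
    D.Q (D.wick x b) = D.wick (D.Q x) b := by
  have : D.Q ∘ₗ D.wick.flip b = D.wick.flip b ∘ₗ D.Q :=
    linearMap_ext_of_isInternal D.parity_internal fun i a ha => by
      have h := D.Q_wick i a b ha
      simpa [hb] using h
  exact congrArg (fun f => f x) this

/-- Changing the sign of the odd part of `a` absorbs the sign in the Leibniz rule; both components
of a closed `a` are closed. -/
theorem exists_Q_eq_wick_Q {a : V} (ha : D.Q a = 0) (x : V) :
    D.Q (D.wick (gradedProj D.parity_internal 0 a) x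
      - D.wick (gradedProj D.parity_internal 1 a) x) = D.wick a (D.Q x) := by
  have h₀ := D.Q_wick 0 _ x (gradedProj_mem D.parity_internal 0 a)
  have h₁ := D.Q_wick 1 _ x (gradedProj_mem D.parity_internal 1 a)
  rw [D.Q_gradedProj, ha, map_zero, map_zero, LinearMap.zero_apply, zero_add] at h₀ h₁
  conv_rhs => rw [← gradedProj_zero_add_one D.parity_internal a]
  rw [map_sub, h₀, h₁, show (-1 : ℤˣ) ^ (1 : ZMod 2) = -1 by decide]
  simp

/-- A homogeneous subspace `W`, closed under all operations, on which the structure on `V` descends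
to the cohomology of `W`. -/
structure IsAdapted (Δ : Module.End K V) (W : Submodule K V) : Prop where
  one_mem : D.one ∈ W
  wick_mem : ∀ a ∈ W, ∀ b ∈ W, D.wick a b ∈ W
  op_mem : ∀ a ∈ W, Δ a ∈ W
  proj_mem : ∀ i, ∀ a ∈ W, gradedProj D.parity_internal i a ∈ W
  exact_mem : ∀ a ∈ W, a ∈ LinearMap.range D.Q → ∃ b ∈ W, D.Q b = a
  anticomm : ∀ a ∈ W, D.Q (Δ a) + Δ (D.Q a) = 0
  commAssoc : D.WickCommAssocOn W

/-- The closed elements of `W`. -/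
abbrev cycles (W : Submodule K V) : Submodule K V := W ⊓ LinearMap.ker D.Q

/-- A presentation `π : Ker Q ∩ W → H` of a super vector space `H` as the cohomology of `W`. -/
structure IsCohomologyMap (W : Submodule K V) {H : Type*} [AddCommGroup H] [Module K H]
    (𝓗 : ZMod 2 → Submodule K H) (π : D.cycles W →ₗ[K] H) : Prop where
  surjective : Function.Surjective π
  eq_zero_iff : ∀ z, π z = 0 ↔ (z : V) ∈ LinearMap.range D.Q
  mem_iff : ∀ i h, h ∈ 𝓗 i ↔ ∃ z : D.cycles W, (z : V) ∈ D.parity i ∧ π z = h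

variable {D} {Δ : Module.End K V} {W : Submodule K V}

theorem Q_coe_cycles (z : D.cycles W) : D.Q z = 0 := LinearMap.mem_ker.mp z.2.2

namespace IsAdapted

/-- The Wick product of closed elements. -/
def cyclesWick (hW : D.IsAdapted Δ W) : D.cycles W →ₗ[K] D.cycles W →ₗ[K] D.cycles W :=
  LinearMap.mk₂ K
    (fun a b => ⟨D.wick a b, hW.wick_mem _ a.2.1 _ b.2.1, by
      refine LinearMap.mem_ker.mpr ?_
      rw [D.Q_wick_of_closed_right _ (Q_coe_cycles b), Q_coe_cycles a, map_zero,
        LinearMap.zero_apply]⟩)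
    (fun a a' b => by ext; simp) (fun c a b => by ext; simp)
    (fun a b b' => by ext; simp) (fun c a b => by ext; simp)

@[simp] theorem coe_cyclesWick (hW : D.IsAdapted Δ W) (a b : D.cycles W) :
    (hW.cyclesWick a b : V) = D.wick a b := rfl

/-- The operator `Δ` on closed elements. -/
def cyclesOp (hW : D.IsAdapted Δ W) : Module.End K (D.cycles W) :=
  Δ.restrict fun a ha => ⟨hW.op_mem a ha.1, by
    have h := hW.anticomm a ha.1
    have ha' : D.Q a = 0 := ha.2
    rwa [ha', map_zero, add_zero] at h⟩

@[simp] theorem coe_cyclesOp (hW : D.IsAdapted Δ W) (a : D.cycles W) :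
    (hW.cyclesOp a : V) = Δ a := rfl

/-- The vacuum as a closed element. -/
def cyclesOne [CharZero K] (hW : D.IsAdapted Δ W) : D.cycles W := ⟨D.one, hW.one_mem, D.Q_one⟩

/-- The homogeneous components of a closed element. -/
def cyclesProj (hW : D.IsAdapted Δ W) (i : ZMod 2) (a : D.cycles W) : D.cycles W :=
  ⟨gradedProj D.parity_internal i a, hW.proj_mem i a a.2.1, by
    refine LinearMap.mem_ker.mpr ?_
    rw [D.Q_gradedProj, Q_coe_cycles a, map_zero]⟩

theorem cyclesProj_zero_add_one (hW : D.IsAdapted Δ W) (a : D.cycles W) :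
    hW.cyclesProj 0 a + hW.cyclesProj 1 a = a :=
  Subtype.ext (gradedProj_zero_add_one D.parity_internal (a : V))

variable {H : Type*} [AddCommGroup H] [Module K H] {𝓗 : ZMod 2 → Submodule K H}
  {π : D.cycles W →ₗ[K] H}

theorem map_eq_map_iff (hπ : D.IsCohomologyMap W 𝓗 π) (z w : D.cycles W) :
    π z = π w ↔ (z : V) - w ∈ LinearMap.range D.Q := by
  rw [← sub_eq_zero, ← map_sub, hπ.eq_zero_iff]
  rfl

theorem map_mem (hπ : D.IsCohomologyMap W 𝓗 π) {i : ZMod 2} {z : D.cycles W}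
    (hz : (z : V) ∈ D.parity i) : π z ∈ 𝓗 i :=
  (hπ.mem_iff i _).mpr ⟨z, hz, rfl⟩

theorem isInternal (hW : D.IsAdapted Δ W) (hπ : D.IsCohomologyMap W 𝓗 π) :
    DirectSum.IsInternal 𝓗 := by
  rw [DirectSum.isInternal_submodule_iff_isCompl 𝓗 (i := 0) (j := 1) (by decide)
    (Set.eq_univ_of_forall fun i => by simpa using zmod_two_eq_zero_or_one i).symm]
  refine ⟨Submodule.disjoint_def.mpr fun h h₀ h₁ => ?_, codisjoint_iff_le_sup.mpr fun h _ => ?_⟩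
  · obtain ⟨z, hz, rfl⟩ := (hπ.mem_iff _ _).mp h₀
    obtain ⟨w, hw, hzw⟩ := (hπ.mem_iff _ _).mp h₁
    obtain ⟨b, hb⟩ := (map_eq_map_iff hπ z w).mp hzw.symm
    rw [hπ.eq_zero_iff]
    -- If `z - w = Q b` with `z` even and `w` odd, the odd part of `b` is a primitive of `z`.
    refine ⟨gradedProj D.parity_internal 1 b, ?_⟩
    rw [D.Q_gradedProj, hb, map_sub, gradedProj_of_mem _ hz, gradedProj_of_mem _ hw,
      show (1 : ZMod 2) + 1 = 0 by decide]
    simp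
  · obtain ⟨z, rfl⟩ := hπ.surjective h
    rw [← hW.cyclesProj_zero_add_one z, map_add]
    exact Submodule.add_mem_sup (map_mem hπ (gradedProj_mem _ _ _))
      (map_mem hπ (gradedProj_mem _ _ _))

theorem map_cyclesWick_congr (hW : D.IsAdapted Δ W) (hπ : D.IsCohomologyMap W 𝓗 π)
    {a a' b b' : D.cycles W} (ha : π a = π a') (hb : π b = π b') :
    π (hW.cyclesWick a b) = π (hW.cyclesWick a' b') := by
  obtain ⟨x, hx⟩ := (map_eq_map_iff hπ a a').mp ha
  obtain ⟨y, hy⟩ := (map_eq_map_iff hπ b b').mp hb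
  rw [map_eq_map_iff hπ]
  have e : (hW.cyclesWick a b : V) - hW.cyclesWick a' b'
      = D.wick (D.Q x) b + D.wick a' (D.Q y) := by
    simp [hx, hy]
  rw [e]
  exact add_mem ⟨_, D.Q_wick_of_closed_right x b.2.2⟩ ⟨_, D.exists_Q_eq_wick_Q a'.2.2 y⟩

theorem map_cyclesOp_congr (hW : D.IsAdapted Δ W) (hπ : D.IsCohomologyMap W 𝓗 π)
    {a a' : D.cycles W} (ha : π a = π a') : π (hW.cyclesOp a) = π (hW.cyclesOp a') := by
  have h := (map_eq_map_iff hπ a a').mp ha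
  -- The primitive must lie in `W`, where alone `Q` and `Δ` are known to anticommute.
  obtain ⟨x, hxW, hx⟩ := hW.exact_mem _ (sub_mem a.2.1 a'.2.1) h
  rw [map_eq_map_iff hπ]
  refine ⟨-Δ x, ?_⟩
  rw [map_neg, coe_cyclesOp, coe_cyclesOp, ← map_sub, ← hx, neg_eq_iff_add_eq_zero]
  exact hW.anticomm x hxW

/-- A linear choice of representatives of cohomology classes. -/
def representative (hπ : D.IsCohomologyMap W 𝓗 π) : H →ₗ[K] D.cycles W :=
  (LinearMap.exists_rightInverse_of_surjective π (LinearMap.range_eq_top.mpr hπ.surjective)).choose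

theorem map_representative (hπ : D.IsCohomologyMap W 𝓗 π) (h : H) :
    π (representative hπ h) = h :=
  congrArg (fun f => f h) (LinearMap.exists_rightInverse_of_surjective π
    (LinearMap.range_eq_top.mpr hπ.surjective)).choose_spec

/-- The product induced by the Wick product in cohomology. -/
def cohomologyMul (hW : D.IsAdapted Δ W) (hπ : D.IsCohomologyMap W 𝓗 π) : H →ₗ[K] H →ₗ[K] H :=
  (hW.cyclesWick.compl₁₂ (representative hπ) (representative hπ)).compr₂ π

theorem cohomologyMul_map (hW : D.IsAdapted Δ W) (hπ : D.IsCohomologyMap W 𝓗 π)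
    (a b : D.cycles W) : hW.cohomologyMul hπ (π a) (π b) = π (hW.cyclesWick a b) :=
  hW.map_cyclesWick_congr hπ (map_representative hπ _) (map_representative hπ _)

/-- The operator induced by `Δ` in cohomology. -/
def cohomologyOp (hW : D.IsAdapted Δ W) (hπ : D.IsCohomologyMap W 𝓗 π) : Module.End K H :=
  π ∘ₗ hW.cyclesOp ∘ₗ representative hπ

theorem cohomologyOp_map (hW : D.IsAdapted Δ W) (hπ : D.IsCohomologyMap W 𝓗 π)
    (a : D.cycles W) : hW.cohomologyOp hπ (π a) = π (hW.cyclesOp a) :=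
  hW.map_cyclesOp_congr hπ (map_representative hπ _)

/-- The cohomology as a supercommutative algebra. -/
def cohomologyAlgebra [CharZero K] (hW : D.IsAdapted Δ W) (hπ : D.IsCohomologyMap W 𝓗 π) :
    SupercommutativeAlgebra K H 𝓗 where
  mul := hW.cohomologyMul hπ
  one := π hW.cyclesOne
  internal := hW.isInternal hπ
  one_mem := map_mem hπ D.one_mem.2
  mul_mem i j a b ha hb := by
    obtain ⟨z, hz, rfl⟩ := (hπ.mem_iff _ _).mp ha
    obtain ⟨w, hw, rfl⟩ := (hπ.mem_iff _ _).mp hb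
    rw [cohomologyMul_map]
    exact map_mem hπ (D.mode_parity i j (-1) _ _ hz hw)
  one_mul a := by
    obtain ⟨z, rfl⟩ := hπ.surjective a
    rw [cohomologyMul_map]
    exact congrArg π (Subtype.ext (D.one_wick z))
  mul_assoc a b c := by
    obtain ⟨z, rfl⟩ := hπ.surjective a
    obtain ⟨w, rfl⟩ := hπ.surjective b
    obtain ⟨u, rfl⟩ := hπ.surjective c
    simp only [cohomologyMul_map]
    rw [map_eq_map_iff hπ]
    exact hW.commAssoc.2 z w u z.2.1 w.2.1 u.2.1 z.2.2 w.2.2 u.2.2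
  mul_comm i j a b ha hb := by
    obtain ⟨z, hz, rfl⟩ := (hπ.mem_iff _ _).mp ha
    obtain ⟨w, hw, rfl⟩ := (hπ.mem_iff _ _).mp hb
    rw [cohomologyMul_map, cohomologyMul_map, ← map_units_int_smul, map_eq_map_iff hπ]
    exact hW.commAssoc.1 i j z w z.2.1 w.2.1 hz hw z.2.2 w.2.2

theorem exists_lInfinityAlgebra [CharZero K] (hW : D.IsAdapted Δ W)
    (hπ : D.IsCohomologyMap W 𝓗 π) (hodd : HasOperatorParity D.parity 1 Δ)
    (hsq : ∀ a, Δ (Δ a) = 0) (hone : Δ D.one = 0) :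
    ∃ L : LInfinityAlgebra K H 𝓗,
      (∀ (r : ℕ) (d : Fin (r + 1) → ZMod 2) (z : Fin (r + 1) → D.cycles W),
        (∀ i, (z i : V) ∈ D.parity (d i)) →
          ∃ w : D.cycles W, (w : V) = D.wickPhi Δ r d (fun i => z i) ∧
            L.bracket (r + 1) (fun i => π (z i)) = π w) ∧
      (∀ (v : V) (k : ℕ), Δ = D.mode k v → ∀ n : ℕ, k + 1 < n → L.bracket n = 0) := by
  let S := hW.cohomologyAlgebra hπ
  have Sone : S.one = π hW.cyclesOne := rfl
  have parity : HasOperatorParity 𝓗 1 (hW.cohomologyOp hπ) := fun i h hh => by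
    obtain ⟨z, hz, rfl⟩ := (hπ.mem_iff _ _).mp hh
    rw [cohomologyOp_map]
    exact map_mem hπ (hodd i z hz)
  have sq (h : H) : hW.cohomologyOp hπ (hW.cohomologyOp hπ h) = 0 := by
    obtain ⟨z, rfl⟩ := hπ.surjective h
    rw [cohomologyOp_map, cohomologyOp_map, ← map_zero π]
    exact congrArg π (Subtype.ext (hsq z))
  have one : hW.cohomologyOp hπ S.one = 0 := by
    rw [Sone, cohomologyOp_map, ← map_zero π]
    exact congrArg π (Subtype.ext hone)
  have formula (r : ℕ) (d : Fin (r + 1) → ZMod 2) (z : Fin (r + 1) → D.cycles W)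
      (hz : ∀ i, (z i : V) ∈ D.parity (d i)) :
      ∃ w : D.cycles W, (w : V) = D.wickPhi Δ r d (fun i => z i) ∧
        (S.lInfinity parity sq one).bracket (r + 1) (fun i => π (z i)) = π w := by
    refine ⟨Phi hW.cyclesWick hW.cyclesOne hW.cyclesOp 1 r d z, ?_, ?_⟩
    · exact Phi_map (D.cycles W).subtype (fun _ _ => rfl) rfl (fun _ => rfl) 1 r d z
    · rw [S.lInfinity_bracket_apply parity sq one r d _ fun i => map_mem hπ (hz i)]
      exact (Phi_map π (fun a b => (hW.cohomologyMul_map hπ a b).symm) rfl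
        (fun a => (hW.cohomologyOp_map hπ a).symm) 1 r d z).symm
  refine ⟨S.lInfinity parity sq one, formula, fun v k hv n hn => ?_⟩
  -- The vector `v` need not be homogeneous, but `Δ` is odd, so the odd part of `v` gives the same
  -- mode.
  obtain ⟨w, hw, hΔ⟩ := D.exists_odd_of_mode_eq hodd hv
  obtain _ | r := n
  · exact absurd hn (Nat.not_lt_zero _)
  refine multilinearMap_eq_zero_of_parity S.internal fun d a ha => ?_
  choose z hz hza using fun i => (hπ.mem_iff _ _).mp (ha i)
  obtain ⟨u, hu, hb⟩ := formula r d z hz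
  have hu0 : u = 0 := Subtype.ext <| hu.trans <| by
    rw [wickPhi, hΔ]
    exact D.Phi_mode_eq_zero k r (Nat.lt_of_succ_lt_succ hn) hw d _ hz
  rw [← funext hza, hb, hu0, map_zero]

end IsAdapted

/-! ### The cases `W = V` and `W = V_[0]` -/

theorem cls_eq_cls_iff {a b : V} (ha : D.Q a = 0) (hb : D.Q b = 0) :
    D.cls a ha = D.cls b hb ↔ a - b ∈ LinearMap.range D.Q := by
  rw [cls, cls, Submodule.Quotient.eq]
  rfl

theorem cls_eq_zero_iff {a : V} (ha : D.Q a = 0) :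
    D.cls a ha = 0 ↔ a ∈ LinearMap.range D.Q := by
  rw [cls, Submodule.Quotient.mk_eq_zero]
  rfl

theorem mem_classesOf {h : D.Cohomology} :
    h ∈ D.classesOf W ↔ ∃ (a : V) (ha : D.Q a = 0), a ∈ W ∧ D.cls a ha = h := by
  constructor
  · rintro ⟨z, hz, rfl⟩
    exact ⟨z, z.2, hz, rfl⟩
  · rintro ⟨a, ha, haW, rfl⟩
    exact ⟨⟨a, ha⟩, haW, rfl⟩

variable (D) in
/-- The cohomology class of a closed element of `W`. -/
def cyclesCls (W : Submodule K V) : D.cycles W →ₗ[K] D.Cohomology :=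
  Submodule.mkQ _ ∘ₗ Submodule.inclusion inf_le_right

theorem cyclesCls_apply (z : D.cycles W) : D.cyclesCls W z = D.cls z (Q_coe_cycles z) := rfl

theorem isCohomologyMap_top : D.IsCohomologyMap ⊤ D.cohomologyParity (D.cyclesCls ⊤) where
  surjective h := by
    obtain ⟨z, rfl⟩ := Submodule.mkQ_surjective _ h
    exact ⟨⟨z, trivial, z.2⟩, rfl⟩
  eq_zero_iff z := by rw [cyclesCls_apply, cls_eq_zero_iff]
  mem_iff i h := by
    rw [cohomologyParity, mem_classesOf]
    constructor
    · rintro ⟨a, ha, hai, rfl⟩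
      exact ⟨⟨a, trivial, ha⟩, hai, rfl⟩
    · rintro ⟨z, hz, rfl⟩
      exact ⟨z, z.2.2, hz, rfl⟩

theorem isAdapted_top (hΔ : ∀ a, D.Q (Δ a) + Δ (D.Q a) = 0) (h : D.WickCommAssocOn ⊤) :
    D.IsAdapted Δ ⊤ where
  one_mem := trivial
  wick_mem _ _ _ _ := trivial
  op_mem _ _ := trivial
  proj_mem _ _ _ := trivial
  exact_mem _ _ := fun ⟨b, hb⟩ => ⟨b, trivial, hb⟩
  anticomm a _ := hΔ a
  commAssoc := h

theorem gradedProj_parity_mem_weight (i : ZMod 2) {n : ℤ} {a : V} (ha : a ∈ D.weight n) :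
    gradedProj D.parity_internal i a ∈ D.weight n := by
  obtain ⟨u, hu, w, hw, rfl⟩ := Submodule.mem_sup.mp (D.weight_le n ha)
  rw [map_add, gradedProj_of_mem _ hu.2, gradedProj_of_mem _ hw.2]
  refine add_mem ?_ ?_ <;> split_ifs
  exacts [hu.1, zero_mem _, hw.1, zero_mem _]

theorem Q_gradedProj_weight (hQ : ∀ (n : ℤ) (a : V), a ∈ D.weight n → D.Q a ∈ D.weight n)
    (n : ℤ) (a : V) :
    D.Q (gradedProj D.weight_internal n a) = gradedProj D.weight_internal n (D.Q a) := by
  have : D.Q ∘ₗ gradedProj D.weight_internal n = gradedProj D.weight_internal n ∘ₗ D.Q :=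
    linearMap_ext_of_isInternal D.weight_internal fun j a ha => by
      simp only [LinearMap.comp_apply, gradedProj_of_mem _ ha, gradedProj_of_mem _ (hQ j a ha)]
      split_ifs <;> simp
  exact congrArg (fun f => f a) this

theorem isAdapted_weight_zero (hweight : ∀ (n : ℤ) (a : V), a ∈ D.weight n → Δ a ∈ D.weight n)
    (hQ : ∀ (n : ℤ) (a : V), a ∈ D.weight n → D.Q a ∈ D.weight n)
    (hΔ : ∀ a ∈ D.weight 0, D.Q (Δ a) + Δ (D.Q a) = 0) (h : D.WickCommAssocOn (D.weight 0)) :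
    D.IsAdapted Δ (D.weight 0) where
  one_mem := D.one_mem.1
  wick_mem a ha b hb := by
    have := D.mode_weight 0 0 (-1) a b ha hb
    rwa [show (0 : ℤ) + 0 - -1 - 1 = 0 by norm_num] at this
  op_mem := hweight 0
  proj_mem i _ ha := gradedProj_parity_mem_weight i ha
  exact_mem := by
    rintro _ ha ⟨b, rfl⟩
    -- As `Q` preserves weights, the weight-zero part of any primitive is again a primitive.
    refine ⟨gradedProj D.weight_internal 0 b, gradedProj_mem _ _ _, ?_⟩
    rw [Q_gradedProj_weight hQ, gradedProj_of_mem _ ha, if_pos rfl]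
  anticomm := hΔ
  commAssoc := h

variable (D) in
/-- The class in `H(V, Q)_[0]` of a closed element of weight zero. -/
def cyclesZeroCls : D.cycles (D.weight 0) →ₗ[K] D.cohomologyZero :=
  (D.cyclesCls (D.weight 0)).codRestrict _ fun z => mem_classesOf.mpr ⟨z, z.2.2, z.2.1, rfl⟩

theorem coe_cyclesZeroCls (z : D.cycles (D.weight 0)) :
    (D.cyclesZeroCls z : D.Cohomology) = D.cls z (Q_coe_cycles z) := rfl

theorem isCohomologyMap_zero :
    D.IsCohomologyMap (D.weight 0) D.cohomologyZeroParity D.cyclesZeroCls where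
  surjective h := by
    obtain ⟨a, ha, haW, e⟩ := mem_classesOf.mp h.2
    exact ⟨⟨a, haW, ha⟩, Subtype.ext e⟩
  eq_zero_iff z := by
    rw [← cls_eq_zero_iff (Q_coe_cycles z), ← coe_cyclesZeroCls, ZeroMemClass.coe_eq_zero]
  mem_iff i h := by
    rw [cohomologyZeroParity, Submodule.mem_comap, cohomologyParity, mem_classesOf]
    constructor
    · rintro ⟨b, hb, hbi, e⟩
      obtain ⟨a, ha, haW, e'⟩ := mem_classesOf.mp h.2
      have hQ : D.Q (gradedProj D.parity_internal i a) = 0 := by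
        rw [D.Q_gradedProj, ha, map_zero]
      -- The class has a representative `a` of weight zero and another, `b`, of parity `i`. The
      -- parity-`i` part of `a` has both properties and differs from `b` by an exact element.
      refine ⟨⟨_, gradedProj_parity_mem_weight i haW, hQ⟩, gradedProj_mem _ _ _, Subtype.ext ?_⟩
      refine Eq.trans ((cls_eq_cls_iff hQ hb).mpr ?_) e
      obtain ⟨y, hy⟩ := (cls_eq_cls_iff ha hb).mp (e'.trans e.symm)
      refine ⟨gradedProj D.parity_internal (i + 1) y, ?_⟩
      rw [D.Q_gradedProj, hy, add_assoc, show (1 : ZMod 2) + 1 = 0 by decide, add_zero, map_sub,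
        gradedProj_of_mem _ hbi, if_pos rfl]
    · rintro ⟨z, hz, rfl⟩
      exact ⟨z, z.2.2, hz, rfl⟩

end DifferentialVOA

end

/-! ### The main theorem -/

theorem mainTheorem3 {K V : Type*} [Field K] [CharZero K] [AddCommGroup V] [Module K V]
    (D : DifferentialVOA K V) (Δ : Module.End K V)
    (hodd : ∀ (i : ZMod 2) (a : V), a ∈ D.parity i → Δ a ∈ D.parity (i + 1))
    (hsq : ∀ a : V, Δ (Δ a) = 0)
    (hweight : ∀ (n : ℤ) (a : V), a ∈ D.weight n → Δ a ∈ D.weight n)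
    (hone : Δ D.one = 0) :
    -- `[Q, Δ] = 0` on all of `V`: the brackets live on `H(V, Q)`
    ((∀ a : V, D.Q (Δ a) + Δ (D.Q a) = 0) → D.WickCommAssocOn ⊤ →
      ∃ L : LInfinityAlgebra K D.Cohomology D.cohomologyParity,
        (∀ (r : ℕ) (d : Fin (r + 1) → ZMod 2) (a : Fin (r + 1) → V)
          (_ : ∀ i, a i ∈ D.parity (d i)) (ha : ∀ i, D.Q (a i) = 0),
          ∃ hΦ : D.Q (D.wickPhi Δ r d a) = 0,
            L.bracket (r + 1) (fun i => D.cls (a i) (ha i)) = D.cls (D.wickPhi Δ r d a) hΦ) ∧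
        (∀ (v : V) (k : ℕ), 1 ≤ k → Δ = D.mode k v → ∀ n : ℕ, k + 1 < n → L.bracket n = 0)) ∧
    -- `[Q, Δ] = 0` only on `V_[0]`: the brackets live on the weight-zero part of `H(V, Q)`
    ((∀ (n : ℤ) (a : V), a ∈ D.weight n → D.Q a ∈ D.weight n) →
      (∀ a ∈ D.weight 0, D.Q (Δ a) + Δ (D.Q a) = 0) → D.WickCommAssocOn (D.weight 0) →
      ∃ L : LInfinityAlgebra K D.cohomologyZero D.cohomologyZeroParity,
        (∀ (r : ℕ) (d : Fin (r + 1) → ZMod 2) (a : Fin (r + 1) → V)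
          (_ : ∀ i, a i ∈ D.parity (d i)) (_ : ∀ i, a i ∈ D.weight 0)
          (ha : ∀ i, D.Q (a i) = 0) (x : Fin (r + 1) → D.cohomologyZero)
          (_ : ∀ i, (x i : D.Cohomology) = D.cls (a i) (ha i)),
          ∃ hΦ : D.Q (D.wickPhi Δ r d a) = 0,
            (L.bracket (r + 1) x : D.Cohomology) = D.cls (D.wickPhi Δ r d a) hΦ) ∧
        (∀ (v : V) (k : ℕ), 1 ≤ k → Δ = D.mode k v → ∀ n : ℕ, k + 1 < n → L.bracket n = 0)) := by
  refine ⟨fun hΔ hcomm => ?_, fun hQ hΔ hcomm => ?_⟩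
  · obtain ⟨L, hL, hvanish⟩ := (DifferentialVOA.isAdapted_top hΔ hcomm).exists_lInfinityAlgebra
      DifferentialVOA.isCohomologyMap_top hodd hsq hone
    refine ⟨L, fun r d a had ha => ?_, fun v k _ hv => hvanish v k hv⟩
    obtain ⟨w, hw, e⟩ := hL r d (fun i => ⟨a i, trivial, ha i⟩) had
    refine ⟨(congrArg D.Q hw).symm.trans w.2.2, e.trans ?_⟩
    rw [DifferentialVOA.cyclesCls_apply]
    congr 1
  · obtain ⟨L, hL, hvanish⟩ := (DifferentialVOA.isAdapted_weight_zero hweight hQ hΔ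
      hcomm).exists_lInfinityAlgebra DifferentialVOA.isCohomologyMap_zero hodd hsq hone
    refine ⟨L, fun r d a had haW ha x hx => ?_, fun v k _ hv => hvanish v k hv⟩
    obtain ⟨w, hw, e⟩ := hL r d (fun i => ⟨a i, haW i, ha i⟩) had
    refine ⟨(congrArg D.Q hw).symm.trans w.2.2, ?_⟩
    have hx' : x = fun i => D.cyclesZeroCls ⟨a i, haW i, ha i⟩ :=
      funext fun i => Subtype.ext (hx i)
    rw [hx', e, DifferentialVOA.coe_cyclesZeroCls]
    congr 1
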